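/- Let $\mathbb X$ and $\mathbb A$ be Borel subsets of Polish spaces. Consider a Markov decision process with state space $\mathbb X$ and action space $\mathbb A$: for every $x\in\mathbb X$ a nonempty Borel set $A(x)\subseteq\mathbb A$ of available actions is given such that the graph $\mathrm{Gr}(A)=\{(x,a):x\in\mathbb X,\ a\in A(x)\}$ is Borel in $\mathbb X\times\mathbb A$ and there is a Borel map $\phi:\mathbb X\to\mathbb A$ with $\phi(x)\in A(x)$ for all $x$ (such maps are the stationary policies, and sequences $\phi_0,\phi_1,\dots$ of them are the Markov policies); the one-step cost $c:\mathrm{Gr}(A)\to(-\infty,+\infty]$ is Borel and bounded below; $q(\cdot|x,a)$ is a probability measure on $\mathbb X$ for $(x,a)\in\mathrm{Gr}(A)$, and $q(B|\cdot)$ is Borel on $\mathrm{Gr}(A)$ for every Borel $B\subseteq\mathbb X$. A policy $\pi$ is a sequence of transition probabilities $\pi_n$ from the histories $h_n=(\xi_0,u_0,\dots,u_{n-1},\xi_n)\in(\mathbb X\times\mathbb A)^n\times\mathbb X$ to $\mathbb A$ with $\pi_n(A(\xi_n)|h_n)=1$; with the initial state $x$ it defines a probability $P^\pi_x$ on the trajectories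 $(\xi_0,u_0,\xi_1,u_1,\dots)$, with expectation $\mathbb E^\pi_x$. For $\alpha\ge 0$ and $n=0,1,\dots$ let $$v^\pi_{n,\alpha}(x)=\mathbb E^\pi_x\sum_{i=0}^{n-1}\alpha^i c(\xi_i,u_i),\qquad v_{n,\alpha}(x)=\inf_\pi v^\pi_{n,\alpha}(x),$$ and for $\alpha\in[0,1)$ let $$v^\pi_{\alpha}(x)=\mathbb E^\pi_x\sum_{i=0}^{\infty}\alpha^i c(\xi_i,u_i),\qquad v_{\alpha}(x)=\inf_\pi v^\pi_{\alpha}(x),$$ where the infima are over all policies and $0\cdot\infty=0$. A policy $\pi$ is $n$-horizon optimal if $v^\pi_{n,\alpha}=v_{n,\alpha}$ on $\mathbb X$, and discount-optimal if $v^\pi_\alpha=v_\alpha$ on $\mathbb X$. Put $\eta^\alpha_u(x,a)=c(x,a)+\alpha\int_{\mathbb X}u(y)\,q(dy|x,a)$. Assumption (W*): (1) $c$ is lower semicontinuous on $\mathrm{Gr}(A)$; (2) if $x_n\to x$ in $\mathbb X$, $a_n\in A(x_n)$, and the sequence $c(x_n,a_n)$ is bounded above by a finite constant, then $(a_n)$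 has a limit point $a\in A(x)$; (3) $q$ is weakly continuous on $\mathrm{Gr}(A)$, that is, $(x,a)\mapsto\int f(z)\,q(dz|x,a)$ is continuous on $\mathrm{Gr}(A)$ for every bounded continuous $f:\mathbb X\to\mathbb R$. Assumption (Wu): $c$ is inf-compact on $\mathrm{Gr}(A)$, that is, $\{(x,a)\in\mathrm{Gr}(A):c(x,a)\le\lambda\}$ is compact for every real $\lambda$, and (3) holds. **Theorem.** Let (W*) hold and let $\alpha\ge0$; in (iv), (v) and wherever $v_\alpha$ occurs, let $\alpha\in[0,1)$. (i) The functions $v_{n,\alpha}$ and $v_\alpha$ are lower semicontinuous on $\mathbb X$, and $v_{n,\alpha}(x)\to v_\alpha(x)$ as $n\to\infty$ for all $x\in\mathbb X$. If $c\ge0$, the convergence is monotone: $v_{n,\alpha}(x)\uparrow v_\alpha(x)$. More generally, if $c\ge K$ on $\mathrm{Gr}(A)$ for a real $K$ and $\alpha\in[0,1)$, then $v_{n,\alpha}(x)-K\sum_{i=0}^{n-1}\alpha^i$ is nondecreasing in $n$. (ii) $v_{0,\alpha}=0$, and for all $n=0,1,\dots$ and $x\in\mathbb X$ $$v_{n+1,\alpha}(x)=\min_{a\in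 A(x)}\eta^\alpha_{v_{n,\alpha}}(x,a).$$ The sets $A_{n,\alpha}(x)=\{a\in A(x):v_{n+1,\alpha}(x)=\eta^\alpha_{v_{n,\alpha}}(x,a)\}$ are nonempty; the graph $\{(x,a):x\in\mathbb X,\ a\in A_{n,\alpha}(x)\}$ is a Borel subset of $\mathbb X\times\mathbb A$; $A_{n,\alpha}(x)=A(x)$ if $v_{n+1,\alpha}(x)=+\infty$, and $A_{n,\alpha}(x)$ is compact if $v_{n+1,\alpha}(x)<+\infty$. (iii) For every $N=1,2,\dots$ there is an $N$-horizon optimal Markov policy, and every Markov policy with $\phi_{N-1-n}(x)\in A_{n,\alpha}(x)$ for all $x\in\mathbb X$ and $n=0,\dots,N-1$ is $N$-horizon optimal. (iv) For all $x\in\mathbb X$ $$v_\alpha(x)=\min_{a\in A(x)}\eta^\alpha_{v_\alpha}(x,a).$$ The sets $A_\alpha(x)=\{a\in A(x):v_\alpha(x)=\eta^\alpha_{v_\alpha}(x,a)\}$ are nonempty; the graph $\{(x,a):x\in\mathbb X,\ a\in A_\alpha(x)\}$ is a Borel subset of $\mathbb X\times\mathbb A$; $A_\alpha(x)=A(x)$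 if $v_\alpha(x)=+\infty$, and $A_\alpha(x)$ is compact if $v_\alpha(x)<+\infty$. (v) There is a stationary discount-optimal policy, and a stationary policy $\phi$ is discount-optimal if and only if $\phi(x)\in A_\alpha(x)$ for all $x\in\mathbb X$. (vi) Under (Wu) (even if (W*) is not assumed), the functions $v_{n,\alpha}$, $n=1,2,\dots$, and $v_\alpha$ are inf-compact on $\mathbb X$: the sets $\{x:v_{n,\alpha}(x)\le\lambda\}$ and $\{x:v_\alpha(x)\le\lambda\}$ are compact for all real $\lambda$. -/

import Mathlib

open MeasureTheory ProbabilityTheory Filter Topology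

noncomputable section

/-- The integral `∫ f⁺ dμ - ∫ f⁻ dμ` of an extended-real-valued function. In this file it is used
only for functions that are almost surely bounded below and for probability measures, so that the
second term is finite. -/
def erealIntegral {Ω : Type*} [MeasurableSpace Ω] (μ : Measure Ω) (f : Ω → EReal) : EReal :=
  ((∫⁻ ω, (f ω).toENNReal ∂μ : ENNReal) : EReal) -
    ((∫⁻ ω, (-f ω).toENNReal ∂μ : ENNReal) : EReal)

/-- The graph of a set-valued mapping. -/
def setGraph {X A : Type*} (F : X → Set A) : Set (X × A) := {p | p.2 ∈ F p.1}

/-- A function is inf-compact on `U` if all its level sets in `U` at finite levels are compact. -/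
def InfCompactOn {Y : Type*} [TopologicalSpace Y] (f : Y → EReal) (U : Set Y) : Prop :=
  ∀ l : ℝ, IsCompact {y | y ∈ U ∧ f y ≤ (l : EReal)}

/-- A Markov decision process with state space `X` and action space `A`. The cost and the transition
probability are total functions, but only their values on the graph of `act` are constrained and
used. -/
structure MDP (X A : Type*) [MeasurableSpace X] [MeasurableSpace A] where
  /-- the sets of available actions -/
  act : X → Set A
  act_nonempty : ∀ x, (act x).Nonempty
  act_measurable : ∀ x, MeasurableSet (act x)
  graph_measurable : MeasurableSet (setGraph act)
  exists_selector : ∃ φ : X → A, Measurable φ ∧ ∀ x, φ x ∈ act x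
  /-- the one-step cost, possibly `+∞` -/
  cost : X × A → EReal
  cost_measurable : Measurable fun p : setGraph act => cost p
  cost_bddBelow : ∃ K : ℝ, ∀ p ∈ setGraph act, (K : EReal) ≤ cost p
  /-- the transition probability -/
  q : X × A → Measure X
  q_prob : ∀ p ∈ setGraph act, IsProbabilityMeasure (q p)
  q_measurable : Measurable fun p : setGraph act => q p

/-- Histories `(ξ₀, u₀, …, ξₙ₋₁, uₙ₋₁, ξₙ)` up to time `n`. -/
abbrev History (X A : Type*) (n : ℕ) : Type _ := (Fin n → X × A) × X

namespace MDP

variable {X A : Type*} [MeasurableSpace X] [MeasurableSpace A] (M : MDP X A)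

/-- A (randomized, history-dependent) policy. -/
structure Policy where
  rule : (n : ℕ) → Kernel (History X A n) A
  isMarkov : ∀ n, IsMarkovKernel (rule n)
  rule_act : ∀ n (h : History X A n), rule n h (M.act h.2) = 1

/-- Borel selectors of the action sets, that is, stationary policies. -/
def Selector : Type _ := {φ : X → A // Measurable φ ∧ ∀ x, φ x ∈ M.act x}

/-- The policy given by a Markov policy `φ₀, φ₁, …`. -/
def markovPolicy (φ : ℕ → M.Selector) : M.Policy where
  rule n := Kernel.deterministic (fun h : History X A n => (φ n).1 h.2)
    ((φ n).2.1.comp measurable_snd)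
  isMarkov n := inferInstance
  rule_act n h := by
    rw [Kernel.deterministic_apply, Measure.dirac_apply' _ (M.act_measurable h.2)]
    exact Set.indicator_of_mem ((φ n).2.2 h.2) _

/-- The policy given by a stationary policy `φ`. -/
def stationaryPolicy (φ : M.Selector) : M.Policy := M.markovPolicy fun _ => φ

open Classical in
/-- The transition probability as a kernel on all of `X × A`. Outside the graph of the action sets,
which the process almost surely never leaves, the state is left unchanged. -/
def transKernel : Kernel (X × A) X where
  toFun p := if p ∈ setGraph M.act then M.q p else Measure.dirac p.1
  measurable' := by
    refine measurable_of_restrict_of_restrict_compl M.graph_measurable ?_ ?_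
    · convert M.q_measurable using 1
      funext p
      simp only [Set.domRestrict_apply]
      exact if_pos p.2
    · have h : Measurable fun p : ((setGraph M.act)ᶜ : Set (X × A)) =>
          Measure.dirac (p : X × A).1 :=
        Measure.measurable_dirac.comp (measurable_fst.comp measurable_subtype_coe)
      convert h using 1
      funext p
      simp only [Set.domRestrict_apply]
      exact if_neg p.2

open Classical in
instance : IsMarkovKernel M.transKernel where
  isProbabilityMeasure p := by
    change IsProbabilityMeasure (if p ∈ setGraph M.act then M.q p else Measure.dirac p.1)
    split_ifs with h
    · exact M.q_prob p h
    · infer_instance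

variable {M}

/-- The history at time `n + 1` made of the state-action pairs up to time `n` and the next state. -/
def nextHistory (n : ℕ) (z : ((_ : Finset.Iic n) → X × A) × X) : History X A (n + 1) :=
  (fun i => z.1 ⟨i.1, Finset.mem_Iic.2 (Nat.lt_succ_iff.1 i.2)⟩, z.2)

theorem measurable_nextHistory (n : ℕ) : Measurable (nextHistory (X := X) (A := A) n) := by
  unfold nextHistory
  fun_prop

/-- Given the state-action pairs up to time `n`, the next state is drawn from the transition
probability and the next action from the decision rule at time `n + 1`. -/
def stepKernel (π : M.Policy) (n : ℕ) : Kernel ((_ : Finset.Iic n) → X × A) (X × A) :=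
  (M.transKernel.comap (fun z => z ⟨n, Finset.mem_Iic.2 le_rfl⟩) (measurable_pi_apply _)) ⊗ₖ
    ((π.rule (n + 1)).comap (nextHistory n) (measurable_nextHistory n))

instance (π : M.Policy) (n : ℕ) : IsMarkovKernel (stepKernel π n) := by
  have := π.isMarkov (n + 1)
  unfold stepKernel
  infer_instance

/-- The law of the first state-action pair for the initial state `x`. -/
def initLaw (π : M.Policy) (x : X) : Measure (X × A) :=
  (π.rule 0 (Fin.elim0, x)).map fun a => (x, a)

/-- The law of the trajectory `(ξ₀, u₀), (ξ₁, u₁), …` for the policy `π` and the initial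
state `x`. -/
def law (π : M.Policy) (x : X) : Measure (ℕ → X × A) :=
  Kernel.trajMeasure (X := fun _ => X × A) (initLaw π x) (stepKernel π)

/-- The expected total discounted cost of `π` over the horizon `N`. -/
def costN (α : ℝ) (N : ℕ) (π : M.Policy) (x : X) : EReal :=
  erealIntegral (law π x) fun ω => ∑ n ∈ Finset.range N, ((α ^ n : ℝ) : EReal) * M.cost (ω n)

/-- The expected total discounted cost of `π` over the infinite horizon. -/
def costInf (α : ℝ) (π : M.Policy) (x : X) : EReal :=
  erealIntegral (law π x) fun ω => ∑' n : ℕ, ((α ^ n : ℝ) : EReal) * M.cost (ω n)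

variable (M)

/-- The optimal cost over the horizon `N`. -/
def valueN (α : ℝ) (N : ℕ) (x : X) : EReal := ⨅ π : M.Policy, costN α N π x

/-- The optimal discounted cost over the infinite horizon. -/
def valueInf (α : ℝ) (x : X) : EReal := ⨅ π : M.Policy, costInf α π x

variable {M}

def IsHorizonOptimal (α : ℝ) (N : ℕ) (π : M.Policy) : Prop :=
  ∀ x, costN α N π x = M.valueN α N x

def IsDiscountOptimal (α : ℝ) (π : M.Policy) : Prop :=
  ∀ x, costInf α π x = M.valueInf α x

variable (M)

/-- `η_u^α(x, a) = c(x, a) + α ∫ u(y) q(dy | x, a)`. -/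
def eta (α : ℝ) (u : X → EReal) (x : X) (a : A) : EReal :=
  M.cost (x, a) + (α : EReal) * erealIntegral (M.q (x, a)) u

/-- The optimal actions when `n + 1` steps remain. -/
def argminN (α : ℝ) (n : ℕ) (x : X) : Set A :=
  {a | a ∈ M.act x ∧ M.valueN α (n + 1) x = M.eta α (M.valueN α n) x a}

/-- The optimal actions over the infinite horizon. -/
def argminInf (α : ℝ) (x : X) : Set A :=
  {a | a ∈ M.act x ∧ M.valueInf α x = M.eta α (M.valueInf α) x a}

section Assumptions

variable [TopologicalSpace X] [TopologicalSpace A]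

/-- Weak continuity of the transition probability on the graph of the action sets. -/
def WeaklyContinuous : Prop :=
  ∀ f : BoundedContinuousFunction X ℝ,
    ContinuousOn (fun p : X × A => ∫ z, f z ∂(M.q p)) (setGraph M.act)

/-- Assumption (W*). Boundedness below of the cost is already part of the model. -/
structure AssumptionWStar : Prop where
  lsc : LowerSemicontinuousOn M.cost (setGraph M.act)
  limitPoint : ∀ (x : ℕ → X) (x' : X), Tendsto x atTop (𝓝 x') →
    ∀ a : ℕ → A, (∀ n, a n ∈ M.act (x n)) →
      (∃ L : ℝ, ∀ n, M.cost (x n, a n) ≤ (L : EReal)) →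
        ∃ a' ∈ M.act x', MapClusterPt a' atTop a
  weaklyContinuous : M.WeaklyContinuous

/-- Assumption (Wu). -/
structure AssumptionWu : Prop where
  infCompact : InfCompactOn M.cost (setGraph M.act)
  weaklyContinuous : M.WeaklyContinuous

end Assumptions

end MDP

end

/-! Subtracting a lower bound of the cost, which translates all values by explicit constants, reduces
everything to nonnegative costs. For these, iterate the Bellman operator
`u ↦ inf_{a ∈ A(x)} (c(x, a) + α ∫ u dq(· | x, a))` from `0`. Weak continuity of `q` makes the
integral of a lower semicontinuous function lower semicontinuous, and adding it to `c` keeps the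
limit point property (2) of (W*); hence every iterate is lower semicontinuous and its minimum is
attained. The iterates increase, and compactness of the sublevel sets in `a` allows the minimum over
`a` to be exchanged with their limit, so the limit solves the optimality equation. The sets of
minimizing actions are compact where the value is finite and everything where it is infinite, so a
measurable selection theorem for compact sets yields optimal selectors. Finally, integrating the
one-step inequalities along a trajectory and telescoping bounds the cost of every policy from below
by the iterates, with equality for policies that select minimizers. -/

noncomputable section

/-! ### Integrals of lower semicontinuous functions against weakly convergent measures -/

theorem volume_Ioi_inter_ofReal_lt (s : ENNReal) :
    volume (Set.Ioi (0 : ℝ) ∩ {t | ENNReal.ofReal t < s}) = s := by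
  induction s with
  | top => simp
  | coe s =>
    have : Set.Ioi (0 : ℝ) ∩ {t | ENNReal.ofReal t < s} = Set.Ioo 0 (s : ℝ) := by
      ext t
      refine and_congr_right fun ht => ?_
      rw [Set.mem_ofPred_eq, ← ENNReal.ofReal_coe_nnreal,
        ENNReal.ofReal_lt_ofReal_iff_of_nonneg (le_of_lt ht)]
    rw [this, Real.volume_Ioo, sub_zero, ENNReal.ofReal_coe_nnreal]

theorem lintegral_eq_lintegral_meas_ofReal_lt {Ω : Type*} [MeasurableSpace Ω] (μ : Measure Ω)
    [SFinite μ] {u : Ω → ENNReal} (hu : Measurable u) :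
    ∫⁻ x, u x ∂μ = ∫⁻ t in Set.Ioi (0 : ℝ), μ {x | ENNReal.ofReal t < u x} := by
  have hS : MeasurableSet {p : Ω × ℝ | ENNReal.ofReal p.2 < u p.1} :=
    measurableSet_lt (by fun_prop) (by fun_prop)
  calc ∫⁻ x, u x ∂μ
      = ∫⁻ x, volume.restrict (Set.Ioi 0) {t | ENNReal.ofReal t < u x} ∂μ := by
        refine lintegral_congr fun x => ?_
        rw [Measure.restrict_apply' measurableSet_Ioi, Set.inter_comm,
          volume_Ioi_inter_ofReal_lt]
    _ = μ.prod (volume.restrict (Set.Ioi 0)) {p : Ω × ℝ | ENNReal.ofReal p.2 < u p.1} :=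
        (Measure.prod_apply hS).symm
    _ = ∫⁻ t in Set.Ioi (0 : ℝ), μ {x | ENNReal.ofReal t < u x} := Measure.prod_apply_symm hS

theorem lintegral_le_liminf_lintegral_of_forall_isOpen {Ω ι : Type*} [MeasurableSpace Ω]
    [TopologicalSpace Ω] [OpensMeasurableSpace Ω] {L : Filter ι} [L.IsCountablyGenerated]
    {μ : Measure Ω} [SFinite μ] {μs : ι → Measure Ω} [∀ i, SFinite (μs i)] {u : Ω → ENNReal}
    (hu : LowerSemicontinuous u)
    (hopen : ∀ G, IsOpen G → μ G ≤ L.liminf fun i => μs i G) :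
    ∫⁻ x, u x ∂μ ≤ L.liminf fun i => ∫⁻ x, u x ∂(μs i) := by
  simp_rw [fun ν : Measure Ω => fun [SFinite ν] =>
    lintegral_eq_lintegral_meas_ofReal_lt ν hu.measurable]
  refine (lintegral_mono fun t => hopen _ (hu.isOpen_preimage _)).trans
    (lintegral_liminf_le fun i => Antitone.measurable fun s t hst => measure_mono fun x hx => ?_)
  exact (ENNReal.ofReal_le_ofReal hst).trans_lt hx

theorem lowerSemicontinuous_lintegral_of_continuous {Y Ω : Type*} [TopologicalSpace Y]
    [FirstCountableTopology Y] [TopologicalSpace Ω] [MeasurableSpace Ω] [OpensMeasurableSpace Ω]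
    [HasOuterApproxClosed Ω] {μ : Y → ProbabilityMeasure Ω} (hμ : Continuous μ)
    {u : Ω → ENNReal} (hu : LowerSemicontinuous u) :
    LowerSemicontinuous fun y => ∫⁻ x, u x ∂(μ y : Measure Ω) :=
  lowerSemicontinuous_iff_le_liminf.2 fun _ =>
    lintegral_le_liminf_lintegral_of_forall_isOpen hu fun _ hG =>
      ProbabilityMeasure.le_liminf_measure_open_of_tendsto hμ.continuousAt hG

/-! ### Measurable selection for compact-valued mappings -/

/-- Measurability of a set-valued mapping: the lower inverse images of closed sets are
measurable. -/
def MeasurableMultifunction {X A : Type*} [MeasurableSpace X] [TopologicalSpace A]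
    (Φ : X → Set A) : Prop :=
  ∀ F, IsClosed F → MeasurableSet {x | (Φ x ∩ F).Nonempty}

namespace MeasurableMultifunction

variable {X A : Type*} [MeasurableSpace X] [MeasurableSpace A] {Φ : X → Set A}

theorem exists_inter_closedBall [PseudoMetricSpace A] [TopologicalSpace.SeparableSpace A]
    (hΦ : MeasurableMultifunction Φ) (hne : ∀ x, (Φ x).Nonempty) {r : ℝ} (hr : 0 < r) :
    ∃ g : X → A, Measurable g ∧ (∀ x, (Φ x ∩ Metric.closedBall (g x) r).Nonempty) ∧
      MeasurableMultifunction fun x => Φ x ∩ Metric.closedBall (g x) r := by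
  classical
  rcases isEmpty_or_nonempty X with hX | ⟨⟨x₀⟩⟩
  · exact ⟨isEmptyElim, measurable_of_empty _, isEmptyElim, fun _ _ => Subsingleton.measurableSet⟩
  have : Nonempty A := ⟨(hne x₀).some⟩
  obtain ⟨d, hd⟩ := TopologicalSpace.exists_dense_seq A
  have hex : ∀ x, ∃ k, (Φ x ∩ Metric.closedBall (d k) r).Nonempty := fun x => by
    obtain ⟨y, hy⟩ := hne x
    obtain ⟨k, hk⟩ := hd.exists_dist_lt y hr
    exact ⟨k, y, hy, hk.le⟩
  have hfind : Measurable fun x => Nat.find (hex x) :=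
    measurable_find hex fun _ => hΦ _ Metric.isClosed_closedBall
  refine ⟨fun x => d (Nat.find (hex x)), measurable_from_nat.comp hfind,
    fun x => Nat.find_spec (hex x), fun F hF => ?_⟩
  have hunion : {x | ((Φ x ∩ Metric.closedBall (d (Nat.find (hex x))) r) ∩ F).Nonempty} =
      ⋃ k : ℕ, (fun x => Nat.find (hex x)) ⁻¹' {k} ∩
        {x | (Φ x ∩ (Metric.closedBall (d k) r ∩ F)).Nonempty} := by
    ext x
    simp only [Set.inter_assoc, Set.mem_iUnion, Set.mem_inter_iff, Set.mem_preimage,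
      Set.mem_singleton_iff, Set.mem_ofPred_eq, exists_eq_left']
  rw [hunion]
  exact MeasurableSet.iUnion fun k => (hfind (measurableSet_singleton k)).inter
    (hΦ _ (Metric.isClosed_closedBall.inter hF))

theorem exists_seq_inter_closedBall [PseudoMetricSpace A] [TopologicalSpace.SeparableSpace A]
    (hΦ : MeasurableMultifunction Φ) (hne : ∀ x, (Φ x).Nonempty) {r : ℕ → ℝ}
    (hr : ∀ n, 0 < r n) :
    ∃ (Ψ : ℕ → X → Set A) (g : ℕ → X → A), Ψ 0 = Φ ∧ (∀ n, Measurable (g n)) ∧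
      (∀ n x, (Ψ n x).Nonempty) ∧
      ∀ n x, Ψ (n + 1) x = Ψ n x ∩ Metric.closedBall (g n x) (r n) := by
  choose g hg hgne hgm using
    fun (n : ℕ) (Ψ : {Ψ : X → Set A // MeasurableMultifunction Ψ ∧ ∀ x, (Ψ x).Nonempty}) =>
      Ψ.2.1.exists_inter_closedBall Ψ.2.2 (hr n)
  let Ψ : ℕ → {Ψ : X → Set A // MeasurableMultifunction Ψ ∧ ∀ x, (Ψ x).Nonempty} :=
    fun n => Nat.rec ⟨Φ, hΦ, hne⟩ (fun n Ψ => ⟨_, hgm n Ψ, hgne n Ψ⟩) n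
  exact ⟨fun n => (Ψ n).1, fun n => g n (Ψ n), rfl, fun n => hg n (Ψ n), fun n => (Ψ n).2.2,
    fun _ _ => rfl⟩

theorem exists_measurable_selector [TopologicalSpace A] [TopologicalSpace.MetrizableSpace A]
    [TopologicalSpace.SeparableSpace A] [BorelSpace A] (hΦ : MeasurableMultifunction Φ)
    (hne : ∀ x, (Φ x).Nonempty) (hc : ∀ x, IsCompact (Φ x)) :
    ∃ φ : X → A, Measurable φ ∧ ∀ x, φ x ∈ Φ x := by
  let _ : MetricSpace A := TopologicalSpace.metrizableSpaceMetric A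
  obtain ⟨Ψ, g, rfl, hg, hΨne, hΨsucc⟩ :=
    hΦ.exists_seq_inter_closedBall hne (r := fun n => (1 / 2 : ℝ) ^ n) fun n => by positivity
  have hclosed : ∀ n x, IsClosed (Ψ n x) := fun n x => by
    induction n with
    | zero => exact (hc x).isClosed
    | succ n ih => rw [hΨsucc]; exact ih.inter Metric.isClosed_closedBall
  have hinter : ∀ x, (⋂ n, Ψ n x).Nonempty := fun x =>
    IsCompact.nonempty_iInter_of_sequence_nonempty_isCompact_isClosed _
      (fun n => by rw [hΨsucc]; exact Set.inter_subset_left) (hΨne · x) (hc x) (hclosed · x)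
  choose φ hφ using hinter
  have hφΨ : ∀ n x, φ x ∈ Ψ n x := fun n x => Set.mem_iInter.1 (hφ x) n
  have hdist : ∀ n x, dist (g n x) (φ x) ≤ (1 / 2 : ℝ) ^ n := fun n x => by
    have hmem := hφΨ (n + 1) x
    rw [hΨsucc] at hmem
    exact (dist_comm _ _).trans_le hmem.2
  refine ⟨φ, measurable_of_tendsto_metrizable hg (tendsto_pi_nhds.2 fun x => ?_), hφΨ 0⟩
  exact tendsto_iff_dist_tendsto_zero.2 <| squeeze_zero (fun _ => dist_nonneg) (hdist · x)
    (tendsto_pow_atTop_nhds_zero_of_lt_one (by norm_num) (by norm_num))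

end MeasurableMultifunction

/-! ### K-inf-compact functions and their minimizers -/

/-- Feinberg's K-inf-compactness in sequential form: `f` is lower semicontinuous on the graph of
`act`, and actions with bounded values along a convergent sequence of states accumulate at an
action available in the limit. -/
structure KInfCompact {X A : Type*} [TopologicalSpace X] [TopologicalSpace A] (act : X → Set A)
    (f : X × A → ENNReal) : Prop where
  lsc : LowerSemicontinuousOn f (setGraph act)
  limitPoint : ∀ (x : ℕ → X) (x' : X), Tendsto x atTop (𝓝 x') →
    ∀ a : ℕ → A, (∀ n, a n ∈ act (x n)) →
      ∀ L : ENNReal, L ≠ ⊤ → (∀ n, f (x n, a n) ≤ L) → ∃ a' ∈ act x', MapClusterPt a' atTop a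

/-- The actions in `act x` that minimize `f (x, ·)` over `act x`. -/
def minimizers {X A : Type*} (act : X → Set A) (f : X × A → ENNReal) (x : X) : Set A :=
  {a | a ∈ act x ∧ f (x, a) = ⨅ b ∈ act x, f (x, b)}

section Minimizers

variable {X A : Type*} {act : X → Set A} {f : X × A → ENNReal}

theorem minimizers_eq_setOf_le (x : X) :
    minimizers act f x = {a | a ∈ act x ∧ f (x, a) ≤ ⨅ b ∈ act x, f (x, b)} :=
  Set.ext fun a => and_congr_right fun ha => ⟨le_of_eq, fun h => h.antisymm (iInf₂_le a ha)⟩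

theorem minimizers_eq_of_iInf_eq_top {x : X} (hx : ⨅ a ∈ act x, f (x, a) = ⊤) :
    minimizers act f x = act x := by
  rw [minimizers_eq_setOf_le, hx]
  simp only [le_top, and_true, Set.ofPred_mem_eq]

variable [TopologicalSpace X] [TopologicalSpace A]

theorem le_of_lowerSemicontinuousOn_of_mapClusterPt (hf : LowerSemicontinuousOn f (setGraph act))
    {x : ℕ → X} {x' : X} (hx : Tendsto x atTop (𝓝 x')) {a : ℕ → A} (ha : ∀ n, a n ∈ act (x n))
    {a' : A} (ha' : a' ∈ act x') (hcl : MapClusterPt a' atTop a) {L : ENNReal}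
    (hle : ∀ n, f (x n, a n) ≤ L) : f (x', a') ≤ L := by
  by_contra! hlt
  have hev := hf (x', a') ha' L hlt
  rw [eventually_nhdsWithin_iff, nhds_prod_eq] at hev
  obtain ⟨P, hP, Q, hQ, hPQ⟩ := eventually_prod_iff.1 hev
  obtain ⟨n, hQn, hPn⟩ := ((hcl.frequently hQ).and_eventually (hx.eventually hP)).exists
  exact (hle n).not_gt (hPQ hPn hQn (ha n))

namespace KInfCompact

theorem of_le (hf : KInfCompact act f) {g : X × A → ENNReal}
    (hg : LowerSemicontinuousOn g (setGraph act)) (hle : ∀ p ∈ setGraph act, f p ≤ g p) :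
    KInfCompact act g where
  lsc := hg
  limitPoint x x' hx a ha L hL hb :=
    hf.limitPoint x x' hx a ha L hL fun n => (hle (x n, a n) (ha n)).trans (hb n)

theorem inter_isClosed (hf : KInfCompact act f) {F : Set A} (hF : IsClosed F) :
    KInfCompact (fun x => act x ∩ F) f where
  lsc := hf.lsc.mono fun _ hp => hp.1
  limitPoint x x' hx a ha L hL hb := by
    obtain ⟨a', ha', hcl⟩ := hf.limitPoint x x' hx a (fun n => (ha n).1) L hL hb
    exact ⟨a', ⟨ha', isClosed_iff_clusterPt.1 hF a'
      (hcl.clusterPt.mono (tendsto_principal.2 (Eventually.of_forall fun n => (ha n).2)))⟩, hcl⟩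

theorem lowerSemicontinuous_iInf [FirstCountableTopology X] (hf : KInfCompact act f) :
    LowerSemicontinuous fun x => ⨅ a ∈ act x, f (x, a) := by
  intro x y hy
  obtain ⟨L, hyL, hL⟩ := exists_between hy
  by_contra hcon
  rw [not_eventually] at hcon
  obtain ⟨xs, hxs, hle⟩ := exists_seq_forall_of_frequently hcon
  have hex : ∀ n, ∃ a ∈ act (xs n), f (xs n, a) < L := fun n => by
    simpa only [iInf_lt_iff, exists_prop] using (not_lt.1 (hle n)).trans_lt hyL
  choose a ha hlt using hex
  obtain ⟨a', ha', hcl⟩ := hf.limitPoint xs x hxs a ha L (ne_top_of_lt hL) fun n => (hlt n).le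
  have hle' : f (x, a') ≤ L := le_of_lowerSemicontinuousOn_of_mapClusterPt hf.lsc hxs ha ha' hcl
    fun n => (hlt n).le
  exact (hL.trans_le (iInf₂_le a' ha')).not_ge hle'

theorem measurableSet_setGraph_minimizers [FirstCountableTopology X] [MeasurableSpace X]
    [OpensMeasurableSpace X] [MeasurableSpace A] (hf : KInfCompact act f)
    (hact : MeasurableSet (setGraph act)) (hfm : Measurable f) :
    MeasurableSet (setGraph (minimizers act f)) :=
  hact.inter <| measurableSet_eq_fun hfm
    (hf.lowerSemicontinuous_iInf.measurable.comp measurable_fst)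

section PseudoMetrizable

variable [TopologicalSpace.PseudoMetrizableSpace A]

theorem isCompact_sublevel (hf : KInfCompact act f) (x : X) {L : ENNReal} (hL : L ≠ ⊤) :
    IsCompact {a | a ∈ act x ∧ f (x, a) ≤ L} := by
  refine IsSeqCompact.isCompact fun a ha => ?_
  obtain ⟨a', ha', hcl⟩ := hf.limitPoint (fun _ => x) x tendsto_const_nhds a (fun n => (ha n).1) L
    hL fun n => (ha n).2
  obtain ⟨ψ, hψ, hlim⟩ := MapClusterPt.tendsto_subseq hcl
  exact ⟨a', ⟨ha', le_of_lowerSemicontinuousOn_of_mapClusterPt hf.lsc tendsto_const_nhds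
    (fun n => (ha n).1) ha' hcl fun n => (ha n).2⟩, ψ, hψ, hlim⟩

theorem minimizers_nonempty (hf : KInfCompact act f) {x : X} (hne : (act x).Nonempty) :
    (minimizers act f x).Nonempty := by
  by_cases htop : ⨅ a ∈ act x, f (x, a) = ⊤
  · rwa [minimizers_eq_of_iInf_eq_top htop]
  obtain ⟨a₀, ha₀, hlt⟩ : ∃ a ∈ act x, f (x, a) < ⊤ := by
    simpa only [iInf_lt_iff, exists_prop] using lt_top_iff_ne_top.2 htop
  have hlsc : LowerSemicontinuousOn (fun a => f (x, a)) {a | a ∈ act x ∧ f (x, a) ≤ f (x, a₀)} :=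
    hf.lsc.comp (by fun_prop) fun a ha => ha.1
  have hmem : a₀ ∈ {a | a ∈ act x ∧ f (x, a) ≤ f (x, a₀)} := ⟨ha₀, le_rfl⟩
  obtain ⟨a, ha, hmin⟩ := hlsc.exists_isMinOn ⟨a₀, hmem⟩ (hf.isCompact_sublevel x hlt.ne)
  rw [minimizers_eq_setOf_le]
  refine ⟨a, ha.1, le_iInf₂ fun b hb => ?_⟩
  rcases le_total (f (x, b)) (f (x, a₀)) with h | h
  · exact hmin ⟨hb, h⟩
  · exact ha.2.trans h

theorem isLeast_iInf (hf : KInfCompact act f) {x : X} (hne : (act x).Nonempty) :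
    IsLeast ((fun a => f (x, a)) '' act x) (⨅ a ∈ act x, f (x, a)) := by
  obtain ⟨a, ha, hmin⟩ := hf.minimizers_nonempty hne
  exact ⟨⟨a, ha, hmin⟩, Set.forall_mem_image.2 fun b hb => iInf₂_le b hb⟩

theorem isCompact_minimizers (hf : KInfCompact act f) {x : X}
    (hx : ⨅ a ∈ act x, f (x, a) ≠ ⊤) : IsCompact (minimizers act f x) := by
  rw [minimizers_eq_setOf_le]
  exact hf.isCompact_sublevel x hx

theorem minimizers_inter_nonempty_iff (hf : KInfCompact act f) {F : Set A} (hF : IsClosed F)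
    {x : X} (hx : ⨅ a ∈ act x, f (x, a) ≠ ⊤) :
    (minimizers act f x ∩ F).Nonempty ↔
      ⨅ a ∈ act x ∩ F, f (x, a) ≤ ⨅ a ∈ act x, f (x, a) := by
  rw [minimizers_eq_setOf_le]
  constructor
  · rintro ⟨a, ⟨ha, hle⟩, haF⟩
    exact (iInf₂_le a ⟨ha, haF⟩).trans hle
  · intro hle
    have hne : (act x ∩ F).Nonempty := by
      by_contra! hemp
      simp only [hemp, Set.mem_empty_iff_false, iInf_false, iInf_top, top_le_iff] at hle
      exact hx hle
    obtain ⟨a, ⟨ha, haF⟩, hmin⟩ := (hf.inter_isClosed hF).minimizers_nonempty hne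
    exact ⟨a, ⟨ha, hmin.trans_le hle⟩, haF⟩

end PseudoMetrizable

variable [TopologicalSpace.MetrizableSpace A]

/-- The exchange of minimum and limit behind the optimality equation. -/
theorem iInf_iSup_eq {f : ℕ → X × A → ENNReal} (hf : ∀ n, KInfCompact act (f n))
    (hmono : Monotone f) {x : X} (hne : (act x).Nonempty) :
    ⨅ a ∈ act x, ⨆ n, f n (x, a) = ⨆ n, ⨅ a ∈ act x, f n (x, a) := by
  refine le_antisymm ?_
    (iSup_le fun n => iInf₂_mono fun a _ => le_iSup (fun n => f n (x, a)) n)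
  set L := ⨆ n, ⨅ a ∈ act x, f n (x, a)
  by_cases hL : L = ⊤
  · exact hL ▸ le_top
  have hcompact : ∀ n, IsCompact {a | a ∈ act x ∧ f n (x, a) ≤ L} := fun n =>
    (hf n).isCompact_sublevel x hL
  have hnonempty : ∀ n, {a | a ∈ act x ∧ f n (x, a) ≤ L}.Nonempty := fun n => by
    obtain ⟨a, ha, hmin⟩ := (hf n).minimizers_nonempty hne
    exact ⟨a, ha, hmin.trans_le (le_iSup (fun n => ⨅ a ∈ act x, f n (x, a)) n)⟩
  have hanti : ∀ n, {a | a ∈ act x ∧ f (n + 1) (x, a) ≤ L} ⊆ {a | a ∈ act x ∧ f n (x, a) ≤ L} :=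
    fun n a ha => ⟨ha.1, (hmono n.le_succ (x, a)).trans ha.2⟩
  obtain ⟨a, ha⟩ := IsCompact.nonempty_iInter_of_sequence_nonempty_isCompact_isClosed _ hanti
    hnonempty (hcompact 0) fun n => (hcompact n).isClosed
  rw [Set.mem_iInter] at ha
  exact (iInf₂_le a (ha 0).1).trans (iSup_le fun n => (ha n).2)

variable [FirstCountableTopology X] [MeasurableSpace X] [OpensMeasurableSpace X]

theorem measurableMultifunction_minimizers (hf : KInfCompact act f) :
    MeasurableMultifunction fun x : {x | ⨅ a ∈ act x, f (x, a) ≠ ⊤} => minimizers act f x := by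
  intro F hF
  have hset : {x : {x | ⨅ a ∈ act x, f (x, a) ≠ ⊤} | (minimizers act f x ∩ F).Nonempty} =
      Subtype.val ⁻¹' {x | ⨅ a ∈ act x ∩ F, f (x, a) ≤ ⨅ a ∈ act x, f (x, a)} :=
    Set.ext fun x => minimizers_inter_nonempty_iff hf hF x.2
  rw [hset]
  exact measurable_subtype_coe <| measurableSet_le
    (hf.inter_isClosed hF).lowerSemicontinuous_iInf.measurable
    hf.lowerSemicontinuous_iInf.measurable

theorem exists_measurable_minimizer [TopologicalSpace.SeparableSpace A] [MeasurableSpace A]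
    [BorelSpace A] (hf : KInfCompact act f) {φ₀ : X → A} (hφ₀ : Measurable φ₀)
    (hφ₀act : ∀ x, φ₀ x ∈ act x) :
    ∃ φ : X → A, Measurable φ ∧ ∀ x, φ x ∈ minimizers act f x := by
  classical
  obtain ⟨ψ, hψ, hψmin⟩ := hf.measurableMultifunction_minimizers.exists_measurable_selector
    (fun x => hf.minimizers_nonempty ⟨_, hφ₀act x⟩) fun x => hf.isCompact_minimizers x.2
  have hfinite : MeasurableSet {x | ⨅ a ∈ act x, f (x, a) ≠ ⊤} :=
    (hf.lowerSemicontinuous_iInf.measurable (measurableSet_singleton ⊤)).compl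
  refine ⟨_, hψ.dite (hφ₀.comp measurable_subtype_coe) hfinite, fun x => ?_⟩
  split_ifs with hx
  · exact hψmin ⟨x, hx⟩
  · rw [minimizers_eq_of_iInf_eq_top (not_not.1 hx)]
    exact hφ₀act x

end KInfCompact

end Minimizers

namespace MDP

variable {X A : Type*} [MeasurableSpace X] [MeasurableSpace A] {M : MDP X A}

/-! ### The law of the trajectory -/

instance isMarkovKernel_rule (π : M.Policy) (n : ℕ) : IsMarkovKernel (π.rule n) := π.isMarkov n

instance isProbabilityMeasure_initLaw (π : M.Policy) (x : X) :
    IsProbabilityMeasure (initLaw π x) :=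
  Measure.isProbabilityMeasure_map (by fun_prop)

instance isProbabilityMeasure_law (π : M.Policy) (x : X) : IsProbabilityMeasure (law π x) := by
  unfold law
  infer_instance

theorem map_eval_zero_law (π : M.Policy) (x : X) :
    (law π x).map (fun ω => ω 0) = initLaw π x := by
  have hfac : (fun ω : ℕ → X × A => ω 0) =
      (MeasurableEquiv.piUnique fun _ : Finset.Iic 0 => X × A) ∘
        Preorder.frestrictLe (π := fun _ => X × A) 0 := rfl
  rw [hfac, ← Measure.map_map (MeasurableEquiv.measurable _) (by fun_prop), law,
    Kernel.trajMeasure, Measure.map_comp _ _ (by fun_prop), Kernel.traj_map_frestrictLe,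
    Kernel.partialTraj_self, Measure.id_comp,
    Measure.map_map (MeasurableEquiv.measurable _) (MeasurableEquiv.measurable _)]
  exact Measure.map_id

theorem map_eval_succ_law (π : M.Policy) (x : X) (n : ℕ) :
    (law π x).map (fun ω => ω (n + 1)) =
      stepKernel π n ∘ₘ (law π x).map (Preorder.frestrictLe (π := fun _ => X × A) n) := by
  rw [← Measure.snd_compProd, law, Kernel.map_frestrictLe_trajMeasure_compProd_eq_map_trajMeasure,
    Measure.snd, Measure.map_map measurable_snd (by fun_prop)]
  rfl

theorem lintegral_law_zero_fst (π : M.Policy) (x : X) {u : X → ENNReal} (hu : Measurable u) :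
    ∫⁻ ω, u (ω 0).1 ∂(law π x) = u x := by
  have hu' : Measurable fun p : X × A => u p.1 := hu.comp measurable_fst
  rw [← lintegral_map (μ := law π x) hu' (measurable_pi_apply 0), map_eval_zero_law, initLaw,
    lintegral_map hu' (by fun_prop)]
  simp only [lintegral_const, measure_univ, mul_one]

theorem lintegral_law_succ_fst (π : M.Policy) (x : X) (n : ℕ) {u : X → ENNReal}
    (hu : Measurable u) :
    ∫⁻ ω, u (ω (n + 1)).1 ∂(law π x) =
      ∫⁻ ω, ∫⁻ y, u y ∂(M.transKernel (ω n)) ∂(law π x) := by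
  have hu' : Measurable fun p : X × A => u p.1 := hu.comp measurable_fst
  have hstep : ∀ z, ∫⁻ p, u p.1 ∂(stepKernel π n z) =
      ∫⁻ y, u y ∂(M.transKernel (z ⟨n, Finset.mem_Iic.2 le_rfl⟩)) := fun z => by
    rw [stepKernel, Kernel.lintegral_compProd _ _ _ hu']
    simp only [lintegral_const, measure_univ, mul_one, Kernel.comap_apply]
  rw [← lintegral_map (μ := law π x) hu' (measurable_pi_apply (n + 1)), map_eval_succ_law,
    Measure.lintegral_bind (Kernel.aemeasurable _) hu'.aemeasurable,
    lintegral_map hu'.lintegral_kernel (by fun_prop)]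
  simp only [hstep]
  rfl

theorem ae_law_mem (π : M.Policy) (x : X) (n : ℕ) {S : Set (X × A)} (hS : MeasurableSet S)
    (h : ∀ h : History X A n, ∀ᵐ a ∂(π.rule n h), (h.2, a) ∈ S) : ∀ᵐ ω ∂(law π x), ω n ∈ S := by
  suffices hmap : ∀ᵐ p ∂(law π x).map fun ω => ω n, p ∈ S from
    ae_of_ae_map (measurable_pi_apply n).aemeasurable hmap
  cases n with
  | zero =>
    rw [map_eval_zero_law, initLaw, ae_map_iff (p := (· ∈ S)) (by fun_prop) hS]
    exact h (Fin.elim0, x)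
  | succ n =>
    rw [map_eval_succ_law]
    refine Measure.ae_comp_of_ae_ae hS (Eventually.of_forall fun z => ?_)
    exact Kernel.ae_compProd_of_ae_ae hS (Eventually.of_forall fun y => h (nextHistory n (z, y)))

theorem ae_law_mem_graph (π : M.Policy) (x : X) (n : ℕ) :
    ∀ᵐ ω ∂(law π x), ω n ∈ setGraph M.act :=
  ae_law_mem π x n M.graph_measurable fun h =>
    (prob_compl_eq_zero_iff (M.act_measurable h.2)).2 (π.rule_act n h)

theorem ae_law_markovPolicy [MeasurableEq A] (φ : ℕ → M.Selector) (x : X) (n : ℕ) :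
    ∀ᵐ ω ∂(law (M.markovPolicy φ) x), (ω n).2 = (φ n).1 (ω n).1 := by
  have hφ : MeasurableSet {p : X × A | p.2 = (φ n).1 p.1} :=
    measurableSet_eq_fun measurable_snd ((φ n).2.1.comp measurable_fst)
  refine ae_law_mem _ x n hφ fun h => ?_
  change ∀ᵐ a ∂(Measure.dirac ((φ n).1 h.2)), a = (φ n).1 h.2
  exact (ae_dirac_iff (measurable_prodMk_left hφ)).2 rfl

theorem transKernel_apply_of_mem {p : X × A} (hp : p ∈ setGraph M.act) :
    M.transKernel p = M.q p := by
  classical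
  exact if_pos hp

/-! ### Dynamic programming for nonnegative costs -/

section Definitions

/-- The one-step cost `c` plus the expected terminal cost `u` discounted by `β`. -/
def oneStep (M : MDP X A) (c : X × A → ENNReal) (β : ENNReal) (u : X → ENNReal) (p : X × A) :
    ENNReal :=
  c p + β * ∫⁻ y, u y ∂(M.transKernel p)

/-- Value iteration started at zero. -/
def iterValue (M : MDP X A) (c : X × A → ENNReal) (β : ENNReal) : ℕ → X → ENNReal
  | 0 => fun _ => 0
  | n + 1 => fun x => ⨅ a ∈ M.act x, M.oneStep c β (iterValue M c β n) (x, a)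

/-- The limit of value iteration. -/
def limValue (M : MDP X A) (c : X × A → ENNReal) (β : ENNReal) (x : X) : ENNReal :=
  ⨆ n, M.iterValue c β n x

/-- The expected total discounted cost over the horizon `N` for a one-step cost `c ≥ 0`. -/
def totalCost (c : X × A → ENNReal) (β : ENNReal) (N : ℕ) (π : M.Policy) (x : X) : ENNReal :=
  ∑ n ∈ Finset.range N, β ^ n * ∫⁻ ω, c (ω n) ∂(law π x)

/-- The expected total discounted cost over the infinite horizon for a one-step cost `c ≥ 0`. -/
def totalCostInf (c : X × A → ENNReal) (β : ENNReal) (π : M.Policy) (x : X) : ENNReal :=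
  ∑' n, β ^ n * ∫⁻ ω, c (ω n) ∂(law π x)

end Definitions

variable {c : X × A → ENNReal} {β : ENNReal}

theorem oneStep_mono : Monotone (M.oneStep c β) := by
  intro u w h p
  unfold oneStep
  gcongr
  exact h _

theorem measurable_oneStep (hc : Measurable c) {u : X → ENNReal} (hu : Measurable u) :
    Measurable (M.oneStep c β u) :=
  hc.add (hu.lintegral_kernel.const_mul β)

theorem monotone_iterValue : Monotone (M.iterValue c β) := by
  refine monotone_nat_of_le_succ fun n => ?_
  induction n with
  | zero => exact fun x => zero_le
  | succ n ih => exact fun x => iInf₂_mono fun a _ => oneStep_mono ih _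

theorem tendsto_iterValue (x : X) :
    Tendsto (fun n => M.iterValue c β n x) atTop (𝓝 (M.limValue c β x)) :=
  tendsto_atTop_iSup fun _ _ h => monotone_iterValue h x

theorem oneStep_limValue (hm : ∀ n, Measurable (M.iterValue c β n)) (p : X × A) :
    M.oneStep c β (M.limValue c β) p = ⨆ n, M.oneStep c β (M.iterValue c β n) p := by
  unfold oneStep limValue
  rw [lintegral_iSup hm monotone_iterValue, ENNReal.mul_iSup, ENNReal.add_iSup]

theorem totalCostInf_eq_iSup (π : M.Policy) (x : X) :
    totalCostInf c β π x = ⨆ N, totalCost c β N π x :=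
  ENNReal.tsum_eq_iSup_nat

section Verification

theorem totalCost_succ_add (hc : Measurable c) (N : ℕ) (π : M.Policy) (x : X) {u : X → ENNReal}
    (hu : Measurable u) :
    totalCost c β (N + 1) π x + β ^ (N + 1) * ∫⁻ ω, u (ω (N + 1)).1 ∂(law π x) =
      totalCost c β N π x + β ^ N * ∫⁻ ω, M.oneStep c β u (ω N) ∂(law π x) := by
  unfold oneStep
  have hcN : Measurable fun ω : ℕ → X × A => c (ω N) := hc.comp (measurable_pi_apply N)
  have huN : Measurable fun ω : ℕ → X × A => ∫⁻ y, u y ∂(M.transKernel (ω N)) :=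
    hu.lintegral_kernel.comp (measurable_pi_apply N)
  rw [lintegral_add_left hcN, lintegral_const_mul _ huN, lintegral_law_succ_fst π x N hu,
    totalCost, totalCost, Finset.sum_range_succ, pow_succ]
  ring

variable (hc : Measurable c) {N : ℕ} {π : M.Policy} {x : X} {w : ℕ → X → ENNReal}
  (hw : ∀ n, Measurable (w n))

include hc hw

theorem totalCost_add_le_of_ae_oneStep_le
    (h : ∀ n < N, ∀ᵐ ω ∂(law π x), M.oneStep c β (w (n + 1)) (ω n) ≤ w n (ω n).1) :
    totalCost c β N π x + β ^ N * ∫⁻ ω, w N (ω N).1 ∂(law π x) ≤ w 0 x := by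
  induction N with
  | zero => simp only [totalCost, Finset.range_zero, Finset.sum_empty, pow_zero, one_mul, zero_add,
      lintegral_law_zero_fst π x (hw 0), le_refl]
  | succ N ih =>
    rw [totalCost_succ_add hc N π x (hw (N + 1))]
    refine le_trans ?_ (ih fun n hn => h n (by omega))
    gcongr totalCost c β N π x + β ^ N * ?_
    exact lintegral_mono_ae (h N N.lt_succ_self)

theorem le_totalCost_add_of_ae_le_oneStep
    (h : ∀ n < N, ∀ᵐ ω ∂(law π x), w n (ω n).1 ≤ M.oneStep c β (w (n + 1)) (ω n)) :
    w 0 x ≤ totalCost c β N π x + β ^ N * ∫⁻ ω, w N (ω N).1 ∂(law π x) := by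
  induction N with
  | zero => simp only [totalCost, Finset.range_zero, Finset.sum_empty, pow_zero, one_mul, zero_add,
      lintegral_law_zero_fst π x (hw 0), le_refl]
  | succ N ih =>
    rw [totalCost_succ_add hc N π x (hw (N + 1))]
    refine (ih fun n hn => h n (by omega)).trans ?_
    gcongr totalCost c β N π x + β ^ N * ?_
    exact lintegral_mono_ae (h N N.lt_succ_self)

end Verification

theorem totalCostInf_stationaryPolicy_le [MeasurableEq A] (hc : Measurable c) (φ : M.Selector)
    {u : X → ENNReal} (hu : Measurable u) (hφ : ∀ x, M.oneStep c β u (x, φ.1 x) ≤ u x) (x : X) :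
    totalCostInf c β (M.stationaryPolicy φ) x ≤ u x := by
  rw [totalCostInf_eq_iSup]
  refine iSup_le fun N => le_self_add.trans
    (totalCost_add_le_of_ae_oneStep_le hc (w := fun _ => u) (fun _ => hu) fun n _ => ?_)
  filter_upwards [ae_law_markovPolicy (fun _ => φ) x n] with ω hω
  have hle := hφ (ω n).1
  rwa [← hω] at hle

section IterValue

variable (hc : Measurable c) (hm : ∀ n, Measurable (M.iterValue c β n))

include hc hm

theorem iterValue_le_totalCost (N : ℕ) (π : M.Policy) (x : X) :
    M.iterValue c β N x ≤ totalCost c β N π x := by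
  have h := le_totalCost_add_of_ae_le_oneStep (β := β) (N := N) (π := π) (x := x)
    (w := fun n => M.iterValue c β (N - n)) hc (fun n => hm (N - n)) fun n hn => by
      filter_upwards [ae_law_mem_graph π x n] with ω hω
      rw [show N - n = N - (n + 1) + 1 by omega]
      exact iInf₂_le (ω n).2 hω
  simpa only [Nat.sub_zero, Nat.sub_self, iterValue, lintegral_zero, mul_zero, add_zero] using h

theorem limValue_le_totalCostInf (π : M.Policy) (x : X) :
    M.limValue c β x ≤ totalCostInf c β π x := by
  rw [totalCostInf_eq_iSup]
  exact iSup_mono fun N => iterValue_le_totalCost hc hm N π x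

theorem totalCost_markovPolicy [MeasurableEq A] {N : ℕ} {φ : ℕ → M.Selector}
    (hφ : ∀ n < N, ∀ x,
      (φ (N - 1 - n)).1 x ∈ minimizers M.act (M.oneStep c β (M.iterValue c β n)) x)
    (x : X) : totalCost c β N (M.markovPolicy φ) x = M.iterValue c β N x := by
  refine (iterValue_le_totalCost hc hm N _ x).antisymm' (le_self_add.trans
    (totalCost_add_le_of_ae_oneStep_le (w := fun n => M.iterValue c β (N - n)) hc
      (fun n => hm (N - n)) fun n hn => ?_))
  filter_upwards [ae_law_markovPolicy φ x n] with ω hω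
  have hmin := (hφ (N - (n + 1)) (by omega) (ω n).1).2
  rw [show N - 1 - (N - (n + 1)) = n by omega, ← hω] at hmin
  rw [show N - n = N - (n + 1) + 1 by omega]
  exact hmin.le

theorem oneStep_limValue_le_totalCostInf [MeasurableEq A] (φ : M.Selector) (x : X) :
    M.oneStep c β (M.limValue c β) (x, φ.1 x) ≤ totalCostInf c β (M.stationaryPolicy φ) x := by
  rw [oneStep_limValue hm, totalCostInf_eq_iSup]
  refine iSup_le fun N => le_iSup_of_le (N + 1) ?_
  let w : ℕ → X → ENNReal
    | 0 => fun y => M.oneStep c β (M.iterValue c β N) (y, φ.1 y)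
    | n + 1 => M.iterValue c β (N - n)
  have hw : ∀ n, Measurable (w n)
    | 0 => (measurable_oneStep hc (hm N)).comp (measurable_id.prodMk φ.2.1)
    | n + 1 => hm (N - n)
  have hae : ∀ n < N + 1, ∀ᵐ ω ∂(law (M.stationaryPolicy φ) x),
      w n (ω n).1 ≤ M.oneStep c β (w (n + 1)) (ω n)
    | 0, _ => by
      filter_upwards [ae_law_markovPolicy (fun _ => φ) x 0] with ω hω
      simp only [w, ← hω, Nat.sub_zero, Prod.mk.eta, le_refl]
    | n + 1, hn => by
      filter_upwards [ae_law_mem_graph (M.stationaryPolicy φ) x (n + 1)] with ω hω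
      simp only [w, show N - n = N - (n + 1) + 1 by omega]
      exact iInf₂_le (ω (n + 1)).2 hω
  simpa only [w, Nat.sub_self, iterValue, lintegral_zero, mul_zero, add_zero] using
    le_totalCost_add_of_ae_le_oneStep hc hw hae

end IterValue

section Topology

variable [TopologicalSpace X] [TopologicalSpace A] [TopologicalSpace.PseudoMetrizableSpace X]

theorem WeaklyContinuous.lowerSemicontinuousOn_lintegral [OpensMeasurableSpace X]
    [FirstCountableTopology A] (hq : M.WeaklyContinuous) {u : X → ENNReal}
    (hu : LowerSemicontinuous u) :
    LowerSemicontinuousOn (fun p => ∫⁻ y, u y ∂(M.transKernel p)) (setGraph M.act) := by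
  let μ : setGraph M.act → ProbabilityMeasure X := fun p => ⟨M.q p, M.q_prob p p.2⟩
  have hμ : Continuous μ := continuous_iff_continuousAt.2 fun p =>
    ProbabilityMeasure.tendsto_iff_forall_integral_tendsto.2 fun f =>
      (continuousOn_iff_continuous_domRestrict.1 (hq f)).continuousAt
  have hrestrict : (setGraph M.act).domRestrict (fun p => ∫⁻ y, u y ∂(M.transKernel p)) =
      fun p => ∫⁻ y, u y ∂(μ p : Measure X) :=
    funext fun p => congrArg (fun ν => ∫⁻ y, u y ∂ν) (transKernel_apply_of_mem p.2)
  rw [← lowerSemicontinuous_restrict_iff, hrestrict]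
  exact lowerSemicontinuous_lintegral_of_continuous hμ hu

/-- Assumption (W*) with the cost of `M` replaced by a nonnegative cost `c` that is measurable on
all of `X × A`. -/
structure WStarCost (M : MDP X A) (c : X × A → ENNReal) : Prop where
  measurable : Measurable c
  kInfCompact : KInfCompact M.act c
  weaklyContinuous : M.WeaklyContinuous

namespace WStarCost

section FirstCountable

variable [OpensMeasurableSpace X] [FirstCountableTopology A] (hc : M.WStarCost c) (α : NNReal)

include hc

theorem kInfCompact_oneStep {u : X → ENNReal} (hu : LowerSemicontinuous u) :
    KInfCompact M.act (M.oneStep c α u) := by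
  refine hc.kInfCompact.of_le (hc.kInfCompact.lsc.add ?_) fun p _ => le_self_add
  exact (ENNReal.continuous_const_mul ENNReal.coe_ne_top).comp_lowerSemicontinuousOn
    (hc.weaklyContinuous.lowerSemicontinuousOn_lintegral hu) fun _ _ h => mul_le_mul_right h _

theorem lowerSemicontinuous_iterValue (n : ℕ) : LowerSemicontinuous (M.iterValue c α n) := by
  induction n with
  | zero => exact lowerSemicontinuous_const
  | succ n ih => exact (hc.kInfCompact_oneStep α ih).lowerSemicontinuous_iInf

theorem lowerSemicontinuous_limValue : LowerSemicontinuous (M.limValue c α) :=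
  lowerSemicontinuous_iSup (hc.lowerSemicontinuous_iterValue α)

theorem measurable_iterValue (n : ℕ) : Measurable (M.iterValue c α n) :=
  (hc.lowerSemicontinuous_iterValue α n).measurable

theorem measurable_limValue : Measurable (M.limValue c α) :=
  (hc.lowerSemicontinuous_limValue α).measurable

theorem kInfCompact_oneStep_iterValue (n : ℕ) :
    KInfCompact M.act (M.oneStep c α (M.iterValue c α n)) :=
  hc.kInfCompact_oneStep α (hc.lowerSemicontinuous_iterValue α n)

theorem kInfCompact_oneStep_limValue : KInfCompact M.act (M.oneStep c α (M.limValue c α)) :=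
  hc.kInfCompact_oneStep α (hc.lowerSemicontinuous_limValue α)

end FirstCountable

section Metrizable

variable [TopologicalSpace.MetrizableSpace A] (α : NNReal)

theorem limValue_eq_iInf [OpensMeasurableSpace X] (hc : M.WStarCost c) (x : X) :
    M.limValue c α x = ⨅ a ∈ M.act x, M.oneStep c α (M.limValue c α) (x, a) := by
  simp only [oneStep_limValue (hc.measurable_iterValue α)]
  rw [KInfCompact.iInf_iSup_eq (f := fun n => M.oneStep c α (M.iterValue c α n))
    (hc.kInfCompact_oneStep_iterValue α)
    (oneStep_mono.comp monotone_iterValue) (M.act_nonempty x)]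
  exact (sup_iSup_nat_succ _).symm.trans (bot_sup_eq _)

variable [OpensMeasurableSpace X] [SecondCountableTopology A] [BorelSpace A] (hc : M.WStarCost c)

include hc

theorem exists_selector_minimizers {u : X → ENNReal} (hu : LowerSemicontinuous u) :
    ∃ φ : M.Selector, ∀ x, φ.1 x ∈ minimizers M.act (M.oneStep c α u) x := by
  obtain ⟨φ₀, hφ₀, hφ₀act⟩ := M.exists_selector
  obtain ⟨φ, hφ, hmin⟩ := (hc.kInfCompact_oneStep α hu).exists_measurable_minimizer hφ₀ hφ₀act
  exact ⟨⟨φ, hφ, fun x => (hmin x).1⟩, hmin⟩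

theorem exists_markovPolicy_totalCost_eq (N : ℕ) :
    ∃ φ : ℕ → M.Selector, ∀ x, totalCost c α N (M.markovPolicy φ) x = M.iterValue c α N x := by
  choose φ hφ using fun n =>
    hc.exists_selector_minimizers α (hc.lowerSemicontinuous_iterValue α n)
  refine ⟨fun k => φ (N - 1 - k), totalCost_markovPolicy hc.measurable
    (hc.measurable_iterValue α) fun n hn x => ?_⟩
  rw [show N - 1 - (N - 1 - n) = n by omega]
  exact hφ n x

theorem totalCostInf_stationaryPolicy_eq_iff (φ : M.Selector) :
    (∀ x, totalCostInf c α (M.stationaryPolicy φ) x = M.limValue c α x) ↔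
      ∀ x, φ.1 x ∈ minimizers M.act (M.oneStep c α (M.limValue c α)) x := by
  have hm := hc.measurable_iterValue α
  constructor
  · intro h x
    rw [minimizers_eq_setOf_le]
    refine ⟨φ.2.2 x, ?_⟩
    rw [← hc.limValue_eq_iInf α x, ← h x]
    exact oneStep_limValue_le_totalCostInf hc.measurable hm φ x
  · intro h x
    refine le_antisymm (totalCostInf_stationaryPolicy_le hc.measurable φ
      (hc.measurable_limValue α) (fun y => ?_) x)
      (limValue_le_totalCostInf hc.measurable hm _ x)
    exact ((h y).2.trans (hc.limValue_eq_iInf α y).symm).le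

theorem exists_stationaryPolicy_totalCostInf_eq :
    ∃ φ : M.Selector, ∀ x, totalCostInf c α (M.stationaryPolicy φ) x = M.limValue c α x := by
  obtain ⟨φ, hφ⟩ := hc.exists_selector_minimizers α (hc.lowerSemicontinuous_limValue α)
  exact ⟨φ, (hc.totalCostInf_stationaryPolicy_eq_iff α φ).2 hφ⟩

theorem iInf_totalCost (N : ℕ) (x : X) :
    ⨅ π : M.Policy, totalCost c α N π x = M.iterValue c α N x := by
  obtain ⟨φ, hφ⟩ := hc.exists_markovPolicy_totalCost_eq α N
  exact le_antisymm ((iInf_le _ (M.markovPolicy φ)).trans (hφ x).le)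
    (le_iInf fun π => iterValue_le_totalCost hc.measurable (hc.measurable_iterValue α) N π x)

theorem iInf_totalCostInf (x : X) :
    ⨅ π : M.Policy, totalCostInf c α π x = M.limValue c α x := by
  obtain ⟨φ, hφ⟩ := hc.exists_stationaryPolicy_totalCostInf_eq α
  exact le_antisymm ((iInf_le _ (M.stationaryPolicy φ)).trans (hφ x).le)
    (le_iInf fun π => limValue_le_totalCostInf hc.measurable (hc.measurable_iterValue α) π x)

end Metrizable

end WStarCost

end Topology

end MDP

/-! ### Extended-real-valued functions that are bounded below -/

theorem coe_sub_coe_eq_of_add_eq_add {s t u v : ENNReal} (ht : t ≠ ⊤) (hv : v ≠ ⊤)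
    (h : s + v = u + t) : (s : EReal) - (t : EReal) = (u : EReal) - (v : EReal) := by
  lift t to NNReal using ht
  lift v to NNReal using hv
  have h' : (s : EReal) + ((v : ℝ) : EReal) = (u : EReal) + ((t : ℝ) : EReal) := by
    change (s : EReal) + ((v : ENNReal) : EReal) = (u : EReal) + ((t : ENNReal) : EReal)
    rw [← EReal.coe_ennreal_add, h, EReal.coe_ennreal_add]
  calc (s : EReal) - ((t : ℝ) : EReal)
      = (s : EReal) + ((v : ℝ) : EReal) - ((t : ℝ) : EReal) - ((v : ℝ) : EReal) := by
        simp only [sub_eq_add_neg]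
        rw [add_right_comm _ _ (-((t : ℝ) : EReal)), ← sub_eq_add_neg _ ((v : ℝ) : EReal),
          EReal.add_sub_cancel_right]
    _ = (u : EReal) - ((v : ℝ) : EReal) := by rw [h', EReal.add_sub_cancel_right]

theorem erealIntegral_eq_lintegral_sub_lintegral {Ω : Type*} [MeasurableSpace Ω] {μ : Measure Ω}
    {f : Ω → EReal} {g h : Ω → ENNReal} (hg : Measurable g) (hh : Measurable h)
    (hfin : ∫⁻ ω, h ω ∂μ ≠ ⊤) (hf : ∀ᵐ ω ∂μ, f ω = (g ω : EReal) - (h ω : EReal)) :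
    erealIntegral μ f =
      ((∫⁻ ω, g ω ∂μ : ENNReal) : EReal) - ((∫⁻ ω, h ω ∂μ : ENNReal) : EReal) := by
  have hpos : ∫⁻ ω, (f ω).toENNReal ∂μ = ∫⁻ ω, g ω - h ω ∂μ := lintegral_congr_ae <| by
    filter_upwards [hf] with ω hω
    rw [hω, EReal.toENNReal_sub (EReal.coe_ennreal_nonneg _), EReal.toENNReal_coe,
      EReal.toENNReal_coe]
  have hneg : ∫⁻ ω, (-f ω).toENNReal ∂μ = ∫⁻ ω, h ω - g ω ∂μ := lintegral_congr_ae <| by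
    filter_upwards [hf, ae_lt_top hh hfin] with ω hω hlt
    rw [hω, EReal.neg_sub (Or.inl (EReal.coe_ennreal_ne_bot _))
      (Or.inr (EReal.coe_ennreal_eq_top_iff.not.2 hlt.ne)), add_comm, ← sub_eq_add_neg,
      EReal.toENNReal_sub (EReal.coe_ennreal_nonneg _), EReal.toENNReal_coe, EReal.toENNReal_coe]
  rw [erealIntegral, hpos, hneg]
  refine coe_sub_coe_eq_of_add_eq_add
    (ne_top_of_le_ne_top hfin (lintegral_mono fun _ => tsub_le_self)) hfin ?_
  rw [← lintegral_add_right _ hh, ← lintegral_add_left hg]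
  simp only [tsub_add_eq_max, add_tsub_eq_max]

theorem continuous_toENNReal_sub_coe (r : ℝ) :
    Continuous fun t : EReal => (t - (r : EReal)).toENNReal :=
  EReal.continuous_toENNReal.comp <| continuous_iff_continuousAt.2 fun t =>
    (EReal.continuousAt_add (p := (t, ((-r : ℝ) : EReal))) (Or.inr (EReal.coe_ne_bot _))
      (Or.inr (EReal.coe_ne_top _))).comp (f := fun t : EReal => (t, ((-r : ℝ) : EReal)))
      (by fun_prop)

/-- The translation by `r` of a nonnegative extended real, used to pass from costs bounded below to
nonnegative ones. -/
def shiftEReal (r : ℝ) (t : ENNReal) : EReal := (t : EReal) + (r : EReal)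

theorem coe_le_shiftEReal (r : ℝ) (t : ENNReal) : (r : EReal) ≤ shiftEReal r t :=
  le_add_of_nonneg_left (EReal.coe_ennreal_nonneg t)

theorem strictMono_shiftEReal (r : ℝ) : StrictMono (shiftEReal r) := fun _ _ h =>
  EReal.add_lt_add_right_coe (EReal.coe_ennreal_strictMono h) r

theorem tendsto_shiftEReal {ι : Type*} {l : Filter ι} {t : ι → ENNReal} {t' : ENNReal} {r : ι → ℝ}
    {r' : ℝ} (ht : Tendsto t l (𝓝 t')) (hr : Tendsto r l (𝓝 r')) :
    Tendsto (fun i => shiftEReal (r i) (t i)) l (𝓝 (shiftEReal r' t')) := by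
  have hadd : ContinuousAt (fun p : EReal × EReal => p.1 + p.2) ((t' : EReal), (r' : EReal)) :=
    EReal.continuousAt_add (Or.inr (EReal.coe_ne_bot _)) (Or.inr (EReal.coe_ne_top _))
  exact hadd.tendsto.comp ((EReal.tendsto_coe_ennreal.2 ht).prodMk_nhds (EReal.tendsto_coe.2 hr))

theorem continuous_shiftEReal (r : ℝ) : Continuous (shiftEReal r) :=
  continuous_iff_continuousAt.2 fun _ => tendsto_shiftEReal tendsto_id tendsto_const_nhds

theorem shiftEReal_top (r : ℝ) : shiftEReal r ⊤ = ⊤ :=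
  EReal.top_add_coe r

theorem shiftEReal_eq_top_iff {r : ℝ} {t : ENNReal} : shiftEReal r t = ⊤ ↔ t = ⊤ := by
  rw [← shiftEReal_top r, (strictMono_shiftEReal r).injective.eq_iff]

theorem shiftEReal_eq_coe_sub_coe (r : ℝ) (t : ENNReal) :
    shiftEReal r t =
      ((t + ENNReal.ofReal r : ENNReal) : EReal) - (ENNReal.ofReal (-r) : EReal) := by
  rw [EReal.coe_ennreal_add, sub_eq_add_neg, add_assoc, ← sub_eq_add_neg, shiftEReal,
    EReal.coe_real_ereal_eq_coe_toNNReal_sub_coe_toNNReal r]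
  rfl

theorem iInf_shiftEReal {ι : Type*} (r : ℝ) (t : ι → ENNReal) :
    ⨅ i, shiftEReal r (t i) = shiftEReal r (⨅ i, t i) :=
  ((strictMono_shiftEReal r).monotone.map_iInf_of_continuousAt
    (continuous_shiftEReal r).continuousAt (shiftEReal_top r)).symm

theorem shiftEReal_add (r s : ℝ) (t u : ENNReal) :
    shiftEReal (r + s) (t + u) = shiftEReal r t + shiftEReal s u := by
  simp only [shiftEReal, EReal.coe_ennreal_add, EReal.coe_add]
  exact add_add_add_comm _ _ _ _

theorem coe_mul_shiftEReal (α : NNReal) (r : ℝ) (t : ENNReal) :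
    ((α : ℝ) : EReal) * shiftEReal r t = shiftEReal (α * r) (α * t) := by
  rw [shiftEReal, EReal.left_distrib_of_nonneg_of_ne_top (EReal.coe_nonneg.2 α.coe_nonneg)
    (EReal.coe_ne_top _), shiftEReal, EReal.coe_ennreal_mul, EReal.coe_mul]
  rfl

theorem sum_shiftEReal {ι : Type*} (s : Finset ι) (r : ι → ℝ) (t : ι → ENNReal) :
    ∑ i ∈ s, shiftEReal (r i) (t i) = shiftEReal (∑ i ∈ s, r i) (∑ i ∈ s, t i) := by
  classical
  induction s using Finset.induction_on with
  | empty => simp [shiftEReal]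
  | insert i s hi ih => simp only [Finset.sum_insert hi, ih, shiftEReal_add]

theorem tsum_shiftEReal {ι : Type*} {r : ι → ℝ} {r' : ℝ} (hr : HasSum r r') (t : ι → ENNReal) :
    ∑' i, shiftEReal (r i) (t i) = shiftEReal r' (∑' i, t i) := by
  refine HasSum.tsum_eq ?_
  simp only [HasSum, sum_shiftEReal]
  exact tendsto_shiftEReal ENNReal.summable.hasSum hr

theorem erealIntegral_eq_shiftEReal {Ω : Type*} [MeasurableSpace Ω] {μ : Measure Ω}
    [IsProbabilityMeasure μ] {f : Ω → EReal} {g : Ω → ENNReal} {r : ℝ} (hg : Measurable g)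
    (hf : ∀ᵐ ω ∂μ, f ω = shiftEReal r (g ω)) :
    erealIntegral μ f = shiftEReal r (∫⁻ ω, g ω ∂μ) := by
  simp only [shiftEReal_eq_coe_sub_coe] at hf ⊢
  rw [erealIntegral_eq_lintegral_sub_lintegral (hg.add_const _) measurable_const (by simp) hf,
    lintegral_add_left hg]
  simp only [lintegral_const, measure_univ, mul_one]

/-! ### Inf-compact functions -/

namespace InfCompactOn

theorem lowerSemicontinuousOn {Y : Type*} [TopologicalSpace Y] [T2Space Y] {f : Y → EReal}
    {U : Set Y} (hf : InfCompactOn f U) : LowerSemicontinuousOn f U := by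
  intro y _ t ht
  obtain ⟨l, htl, hly⟩ := EReal.lt_iff_exists_real_btwn.1 ht
  have hopen : IsOpen {z | z ∈ U ∧ f z ≤ (l : EReal)}ᶜ := (hf l).isClosed.isOpen_compl
  have hmem : y ∈ {z | z ∈ U ∧ f z ≤ (l : EReal)}ᶜ := fun h => hly.not_ge h.2
  filter_upwards [mem_nhdsWithin_of_mem_nhds (hopen.mem_nhds hmem), self_mem_nhdsWithin]
    with z hz hzU
  exact htl.trans (not_le.1 fun h => hz ⟨hzU, h⟩)

variable {X A : Type*} [TopologicalSpace X] [TopologicalSpace A] {F : X → Set A}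
  {c : X × A → EReal}

theorem exists_mapClusterPt [T2Space X] (hc : InfCompactOn c (setGraph F)) {x : ℕ → X} {x' : X}
    (hx : Tendsto x atTop (𝓝 x')) {a : ℕ → A} (ha : ∀ n, a n ∈ F (x n)) {L : ℝ}
    (hL : ∀ n, c (x n, a n) ≤ (L : EReal)) : ∃ a' ∈ F x', MapClusterPt a' atTop a := by
  obtain ⟨⟨x₁, a₁⟩, ⟨hmem, -⟩, hcl⟩ := (hc L).exists_mapClusterPt
    (f := atTop) (u := fun n => (x n, a n))
    (tendsto_principal.2 (Eventually.of_forall fun n => ⟨ha n, hL n⟩))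
  have hx₁ : MapClusterPt x₁ atTop x :=
    hcl.continuousAt_comp (f := Prod.fst) continuous_fst.continuousAt
  have ha₁ : MapClusterPt a₁ atTop a :=
    hcl.continuousAt_comp (f := Prod.snd) continuous_snd.continuousAt
  have hne : (𝓝 x₁ ⊓ 𝓝 x').NeBot := hx₁.neBot.mono (inf_le_inf_left _ hx)
  exact ⟨a₁, eq_of_nhds_neBot hne ▸ hmem, ha₁⟩

theorem univ_of_exists_add_le (hc : InfCompactOn c (setGraph F)) {v : X → EReal}
    (hv : LowerSemicontinuous v) (s : ℝ) (h : ∀ x, ∃ a ∈ F x, c (x, a) + (s : EReal) ≤ v x) :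
    InfCompactOn v Set.univ := by
  intro l
  simp only [Set.mem_univ, true_and]
  refine ((hc (l - s)).image continuous_fst).of_isClosed_subset
    (hv.isClosed_preimage (l : EReal)) fun x hx => ?_
  obtain ⟨a, ha, hle⟩ := h x
  refine ⟨(x, a), ⟨ha, ?_⟩, rfl⟩
  rw [EReal.coe_sub, EReal.le_sub_iff_add_le (Or.inl (EReal.coe_ne_bot s))
    (Or.inl (EReal.coe_ne_top s))]
  exact hle.trans hx

end InfCompactOn

/-! ### Reduction to nonnegative costs -/

namespace MDP

variable {X A : Type*} [MeasurableSpace X] [MeasurableSpace A] {M : MDP X A} {K : ℝ}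

/-- The excess of the cost over `K`, to which the theory for nonnegative costs is applied. It is
set to zero outside the graph of the action sets, where the cost is arbitrary. -/
def excessCost (M : MDP X A) (K : ℝ) : X × A → ENNReal :=
  (setGraph M.act).indicator fun p => (M.cost p - (K : EReal)).toENNReal

theorem domRestrict_excessCost :
    (setGraph M.act).domRestrict (M.excessCost K) =
      fun p : setGraph M.act => (M.cost p - (K : EReal)).toENNReal :=
  funext fun p => by rw [Set.domRestrict_apply, excessCost, Set.indicator_of_mem p.2]

theorem measurable_excessCost : Measurable (M.excessCost K) := by
  refine measurable_of_restrict_of_restrict_compl M.graph_measurable ?_ ?_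
  · rw [domRestrict_excessCost]
    exact (M.cost_measurable.sub_const _).ereal_toENNReal
  · have hzero : (setGraph M.act)ᶜ.domRestrict (M.excessCost K) = 0 :=
      funext fun p => by simp only [Set.domRestrict_apply, excessCost, Pi.zero_apply,
        Set.indicator_of_notMem p.2]
    exact hzero ▸ measurable_zero

section LowerBound

variable (hK : ∀ p ∈ setGraph M.act, (K : EReal) ≤ M.cost p) (α : NNReal)

include hK

theorem cost_eq_shiftEReal {p : X × A} (hp : p ∈ setGraph M.act) :
    M.cost p = shiftEReal K (M.excessCost K p) := by
  have hnonneg : 0 ≤ M.cost p - (K : EReal) :=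
    (EReal.sub_nonneg (Or.inr (EReal.coe_ne_top _)) (Or.inr (EReal.coe_ne_bot _))).2 (hK p hp)
  rw [shiftEReal, excessCost, Set.indicator_of_mem hp, EReal.coe_toENNReal hnonneg,
    EReal.sub_add_cancel]

theorem coe_pow_mul_cost_eq_shiftEReal {p : X × A} (hp : p ∈ setGraph M.act) (n : ℕ) :
    (((α : ℝ) ^ n : ℝ) : EReal) * M.cost p =
      shiftEReal (K * (α : ℝ) ^ n) ((α : ENNReal) ^ n * M.excessCost K p) := by
  rw [cost_eq_shiftEReal hK hp, ← NNReal.coe_pow, coe_mul_shiftEReal, ENNReal.coe_pow,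
    mul_comm K]

theorem costN_eq_shiftEReal (N : ℕ) (π : M.Policy) (x : X) :
    costN α N π x = shiftEReal (K * ∑ i ∈ Finset.range N, (α : ℝ) ^ i)
      (totalCost (M.excessCost K) α N π x) := by
  have hmeas : ∀ n, Measurable fun ω : ℕ → X × A => M.excessCost K (ω n) := fun n =>
    measurable_excessCost.comp (measurable_pi_apply n)
  rw [totalCost, Finset.sum_congr rfl fun n _ => (lintegral_const_mul _ (hmeas n)).symm,
    ← lintegral_finsetSum _ fun n _ => (hmeas n).const_mul _]
  refine erealIntegral_eq_shiftEReal
    (Finset.measurable_fun_sum _ fun n _ => (hmeas n).const_mul _) ?_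
  filter_upwards [ae_all_iff.2 (ae_law_mem_graph π x)] with ω hω
  simp only [coe_pow_mul_cost_eq_shiftEReal hK α (hω _), sum_shiftEReal, Finset.mul_sum]

theorem costInf_eq_shiftEReal (hα : (α : ℝ) < 1) (π : M.Policy) (x : X) :
    costInf α π x = shiftEReal (K * (1 - (α : ℝ))⁻¹)
      (totalCostInf (M.excessCost K) α π x) := by
  have hmeas : ∀ n, Measurable fun ω : ℕ → X × A => M.excessCost K (ω n) := fun n =>
    measurable_excessCost.comp (measurable_pi_apply n)
  rw [totalCostInf, tsum_congr fun n => (lintegral_const_mul _ (hmeas n)).symm,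
    ← lintegral_tsum fun n => ((hmeas n).const_mul _).aemeasurable]
  refine erealIntegral_eq_shiftEReal (Measurable.tsum fun n => (hmeas n).const_mul _) ?_
  filter_upwards [ae_all_iff.2 (ae_law_mem_graph π x)] with ω hω
  simp only [coe_pow_mul_cost_eq_shiftEReal hK α (hω _)]
  exact tsum_shiftEReal ((hasSum_geometric_of_lt_one α.coe_nonneg hα).mul_left K) _

omit hK in
theorem eta_eq_cost_add {u : X → EReal} {w : X → ENNReal} {r : ℝ} (hw : Measurable w)
    (hu : ∀ x, u x = shiftEReal r (w x)) {x : X} {a : A} (ha : a ∈ M.act x) :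
    M.eta α u x a =
      M.cost (x, a) + shiftEReal (α * r) (α * ∫⁻ y, w y ∂(M.transKernel (x, a))) := by
  have := M.q_prob (x, a) ha
  rw [eta, erealIntegral_eq_shiftEReal hw (Eventually.of_forall hu), coe_mul_shiftEReal,
    transKernel_apply_of_mem ha]

theorem eta_eq_shiftEReal_oneStep {u : X → EReal} {w : X → ENNReal} {r : ℝ} (hw : Measurable w)
    (hu : ∀ x, u x = shiftEReal r (w x)) {x : X} {a : A} (ha : a ∈ M.act x) :
    M.eta α u x a = shiftEReal (K + α * r) (M.oneStep (M.excessCost K) α w (x, a)) := by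
  rw [eta_eq_cost_add α hw hu ha, cost_eq_shiftEReal hK ha, ← shiftEReal_add, oneStep]

end LowerBound

section Topology

variable [TopologicalSpace X] [TopologicalSpace A]

theorem AssumptionWStar.wStarCost_excessCost (hW : M.AssumptionWStar)
    (hK : ∀ p ∈ setGraph M.act, (K : EReal) ≤ M.cost p) : M.WStarCost (M.excessCost K) where
  measurable := measurable_excessCost
  kInfCompact :=
    { lsc := by
        rw [← lowerSemicontinuous_restrict_iff, domRestrict_excessCost]
        exact (continuous_toENNReal_sub_coe K).comp_lowerSemicontinuous
          (lowerSemicontinuous_restrict_iff.2 hW.lsc)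
          fun s t hst => EReal.toENNReal_le_toENNReal (EReal.sub_le_sub hst le_rfl)
      limitPoint := fun x x' hx a ha L hL hb => by
        refine hW.limitPoint x x' hx a ha ⟨L.toReal + K, fun n => ?_⟩
        rw [cost_eq_shiftEReal hK (ha n), EReal.coe_add, EReal.coe_ennreal_toReal hL]
        exact (strictMono_shiftEReal K).monotone (hb n) }
  weaklyContinuous := hW.weaklyContinuous

theorem AssumptionWu.assumptionWStar [T2Space X] [T2Space A] (hWu : M.AssumptionWu) :
    M.AssumptionWStar where
  lsc := hWu.infCompact.lowerSemicontinuousOn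
  limitPoint _ _ hx _ ha hb := hb.elim fun _ hL => hWu.infCompact.exists_mapClusterPt hx ha hL
  weaklyContinuous := hWu.weaklyContinuous

end Topology

end MDP

/-! ### Optimal values and policies -/

namespace MDP

variable {X A : Type*} [MeasurableSpace X] [MeasurableSpace A] {M : MDP X A} {K : ℝ}

theorem valueN_zero (α : ℝ) (x : X) : M.valueN α 0 x = 0 := by
  have hne : Nonempty M.Policy := M.exists_selector.elim fun φ hφ => ⟨M.stationaryPolicy ⟨φ, hφ⟩⟩
  simp [valueN, costN, erealIntegral]

section Eta

variable (hK : ∀ p ∈ setGraph M.act, (K : EReal) ≤ M.cost p) {α : NNReal} {u : X → EReal}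
  {w : X → ENNReal} {r : ℝ} (hw : Measurable w) (hu : ∀ x, u x = shiftEReal r (w x)) (x : X)

include hK hw hu

theorem isLeast_image_eta [TopologicalSpace X] [TopologicalSpace A]
    [TopologicalSpace.PseudoMetrizableSpace A]
    (hf : KInfCompact M.act (M.oneStep (M.excessCost K) α w)) :
    IsLeast (M.eta α u x '' M.act x) (shiftEReal (K + α * r)
      (⨅ a ∈ M.act x, M.oneStep (M.excessCost K) α w (x, a))) := by
  rw [Set.image_congr fun a ha => eta_eq_shiftEReal_oneStep hK α hw hu ha,
    ← Set.image_image (shiftEReal _) fun a => M.oneStep (M.excessCost K) α w (x, a)]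
  exact (strictMono_shiftEReal _).monotone.map_isLeast (hf.isLeast_iInf (M.act_nonempty x))

theorem setOf_eq_eta :
    {a | a ∈ M.act x ∧ shiftEReal (K + α * r)
      (⨅ a ∈ M.act x, M.oneStep (M.excessCost K) α w (x, a)) = M.eta α u x a} =
      minimizers M.act (M.oneStep (M.excessCost K) α w) x := by
  refine Set.ext fun a => and_congr_right fun ha => ?_
  rw [eta_eq_shiftEReal_oneStep hK α hw hu ha, (strictMono_shiftEReal _).injective.eq_iff,
    eq_comm]

end Eta

variable [TopologicalSpace X] [TopologicalSpace A]
  [TopologicalSpace.PseudoMetrizableSpace X] [OpensMeasurableSpace X]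
  [TopologicalSpace.MetrizableSpace A] [SecondCountableTopology A] [BorelSpace A]
  (hK : ∀ p ∈ setGraph M.act, (K : EReal) ≤ M.cost p) (hW : M.AssumptionWStar) (α : NNReal)

include hK hW

theorem valueN_eq_shiftEReal (n : ℕ) (x : X) :
    M.valueN α n x = shiftEReal (K * ∑ i ∈ Finset.range n, (α : ℝ) ^ i)
      (M.iterValue (M.excessCost K) α n x) := by
  have hc := hW.wStarCost_excessCost hK
  rw [valueN, ← hc.iInf_totalCost α n x, ← iInf_shiftEReal]
  exact iInf_congr fun π => costN_eq_shiftEReal hK α n π x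

theorem valueInf_eq_shiftEReal (hα : (α : ℝ) < 1) (x : X) :
    M.valueInf α x = shiftEReal (K * (1 - (α : ℝ))⁻¹) (M.limValue (M.excessCost K) α x) := by
  have hc := hW.wStarCost_excessCost hK
  rw [valueInf, ← hc.iInf_totalCostInf α x, ← iInf_shiftEReal]
  exact iInf_congr fun π => costInf_eq_shiftEReal hK α hα π x

theorem lowerSemicontinuous_valueN (n : ℕ) : LowerSemicontinuous (M.valueN α n) := by
  have hc := hW.wStarCost_excessCost hK
  rw [funext (valueN_eq_shiftEReal hK hW α n)]
  exact (continuous_shiftEReal _).comp_lowerSemicontinuous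
    (hc.lowerSemicontinuous_iterValue α n) (strictMono_shiftEReal _).monotone

theorem lowerSemicontinuous_valueInf (hα : (α : ℝ) < 1) :
    LowerSemicontinuous (M.valueInf α) := by
  have hc := hW.wStarCost_excessCost hK
  rw [funext (valueInf_eq_shiftEReal hK hW α hα)]
  exact (continuous_shiftEReal _).comp_lowerSemicontinuous
    (hc.lowerSemicontinuous_limValue α) (strictMono_shiftEReal _).monotone

theorem tendsto_valueN (hα : (α : ℝ) < 1) (x : X) :
    Tendsto (fun n => M.valueN α n x) atTop (𝓝 (M.valueInf α x)) := by
  simp only [valueN_eq_shiftEReal hK hW, valueInf_eq_shiftEReal hK hW α hα]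
  exact tendsto_shiftEReal (tendsto_iterValue x)
    ((hasSum_geometric_of_lt_one α.coe_nonneg hα).tendsto_sum_nat.const_mul K)

theorem monotone_valueN_sub (x : X) : Monotone fun n =>
    M.valueN α n x - ((K * ∑ i ∈ Finset.range n, (α : ℝ) ^ i : ℝ) : EReal) := by
  simp only [valueN_eq_shiftEReal hK hW, shiftEReal, EReal.add_sub_cancel_right]
  exact fun n m hnm => EReal.coe_ennreal_le_coe_ennreal_iff.2 (monotone_iterValue hnm x)

/-! ### Optimality equations -/

theorem valueN_succ_eq_shiftEReal_iInf (n : ℕ) (x : X) :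
    M.valueN α (n + 1) x =
      shiftEReal (K + α * (K * ∑ i ∈ Finset.range n, (α : ℝ) ^ i)) (⨅ a ∈ M.act x,
        M.oneStep (M.excessCost K) α (M.iterValue (M.excessCost K) α n) (x, a)) := by
  rw [valueN_eq_shiftEReal hK hW, geom_sum_succ, iterValue]
  congr 1
  ring

theorem valueInf_eq_shiftEReal_iInf (hα : (α : ℝ) < 1) (x : X) :
    M.valueInf α x = shiftEReal (K + α * (K * (1 - (α : ℝ))⁻¹)) (⨅ a ∈ M.act x,
        M.oneStep (M.excessCost K) α (M.limValue (M.excessCost K) α) (x, a)) := by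
  have hc := hW.wStarCost_excessCost hK
  rw [valueInf_eq_shiftEReal hK hW α hα, hc.limValue_eq_iInf α x]
  congr 1
  have : 1 - (α : ℝ) ≠ 0 := by linarith
  field_simp
  ring

theorem argminN_eq_minimizers (n : ℕ) :
    M.argminN α n = minimizers M.act
      (M.oneStep (M.excessCost K) α (M.iterValue (M.excessCost K) α n)) := by
  have hc := hW.wStarCost_excessCost hK
  funext x
  rw [argminN, valueN_succ_eq_shiftEReal_iInf hK hW]
  exact setOf_eq_eta hK (hc.measurable_iterValue α n) (valueN_eq_shiftEReal hK hW α n) x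

theorem argminInf_eq_minimizers (hα : (α : ℝ) < 1) :
    M.argminInf α = minimizers M.act
      (M.oneStep (M.excessCost K) α (M.limValue (M.excessCost K) α)) := by
  have hc := hW.wStarCost_excessCost hK
  funext x
  rw [argminInf, valueInf_eq_shiftEReal_iInf hK hW α hα]
  exact setOf_eq_eta hK (hc.measurable_limValue α) (valueInf_eq_shiftEReal hK hW α hα) x

theorem isLeast_valueN_succ (n : ℕ) (x : X) :
    IsLeast (M.eta α (M.valueN α n) x '' M.act x) (M.valueN α (n + 1) x) := by
  have hc := hW.wStarCost_excessCost hK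
  rw [valueN_succ_eq_shiftEReal_iInf hK hW]
  exact isLeast_image_eta hK (hc.measurable_iterValue α n)
    (valueN_eq_shiftEReal hK hW α n) x (hc.kInfCompact_oneStep_iterValue α n)

theorem isLeast_valueInf (hα : (α : ℝ) < 1) (x : X) :
    IsLeast (M.eta α (M.valueInf α) x '' M.act x) (M.valueInf α x) := by
  have hc := hW.wStarCost_excessCost hK
  conv_rhs => rw [valueInf_eq_shiftEReal_iInf hK hW α hα]
  exact isLeast_image_eta hK (hc.measurable_limValue α)
    (valueInf_eq_shiftEReal hK hW α hα) x (hc.kInfCompact_oneStep_limValue α)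

theorem argminN_nonempty (n : ℕ) (x : X) : (M.argminN α n x).Nonempty := by
  obtain ⟨a, ha, h⟩ := (isLeast_valueN_succ hK hW α n x).1
  exact ⟨a, ha, h.symm⟩

theorem argminInf_nonempty (hα : (α : ℝ) < 1) (x : X) : (M.argminInf α x).Nonempty := by
  obtain ⟨a, ha, h⟩ := (isLeast_valueInf hK hW α hα x).1
  exact ⟨a, ha, h.symm⟩

theorem measurableSet_setGraph_argminN (n : ℕ) : MeasurableSet (setGraph (M.argminN α n)) := by
  have hc := hW.wStarCost_excessCost hK
  rw [argminN_eq_minimizers hK hW]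
  exact (hc.kInfCompact_oneStep_iterValue α n).measurableSet_setGraph_minimizers
    M.graph_measurable (measurable_oneStep measurable_excessCost (hc.measurable_iterValue α n))

theorem measurableSet_setGraph_argminInf (hα : (α : ℝ) < 1) :
    MeasurableSet (setGraph (M.argminInf α)) := by
  have hc := hW.wStarCost_excessCost hK
  rw [argminInf_eq_minimizers hK hW α hα]
  exact (hc.kInfCompact_oneStep_limValue α).measurableSet_setGraph_minimizers
    M.graph_measurable (measurable_oneStep measurable_excessCost (hc.measurable_limValue α))

theorem argminN_eq_act {n : ℕ} {x : X} (hx : M.valueN α (n + 1) x = ⊤) :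
    M.argminN α n x = M.act x := by
  rw [valueN_succ_eq_shiftEReal_iInf hK hW, shiftEReal_eq_top_iff] at hx
  rw [argminN_eq_minimizers hK hW, minimizers_eq_of_iInf_eq_top hx]

theorem argminInf_eq_act (hα : (α : ℝ) < 1) {x : X} (hx : M.valueInf α x = ⊤) :
    M.argminInf α x = M.act x := by
  rw [valueInf_eq_shiftEReal_iInf hK hW α hα, shiftEReal_eq_top_iff] at hx
  rw [argminInf_eq_minimizers hK hW α hα, minimizers_eq_of_iInf_eq_top hx]

theorem isCompact_argminN {n : ℕ} {x : X} (hx : M.valueN α (n + 1) x < ⊤) :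
    IsCompact (M.argminN α n x) := by
  have hc := hW.wStarCost_excessCost hK
  rw [valueN_succ_eq_shiftEReal_iInf hK hW, lt_top_iff_ne_top, ne_eq, shiftEReal_eq_top_iff] at hx
  rw [argminN_eq_minimizers hK hW]
  exact (hc.kInfCompact_oneStep_iterValue α n).isCompact_minimizers hx

theorem isCompact_argminInf (hα : (α : ℝ) < 1) {x : X} (hx : M.valueInf α x < ⊤) :
    IsCompact (M.argminInf α x) := by
  have hc := hW.wStarCost_excessCost hK
  rw [valueInf_eq_shiftEReal_iInf hK hW α hα, lt_top_iff_ne_top, ne_eq,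
    shiftEReal_eq_top_iff] at hx
  rw [argminInf_eq_minimizers hK hW α hα]
  exact (hc.kInfCompact_oneStep_limValue α).isCompact_minimizers hx

/-! ### Optimal policies -/

theorem isHorizonOptimal_iff {N : ℕ} {π : M.Policy} : IsHorizonOptimal α N π ↔
    ∀ x, totalCost (M.excessCost K) α N π x = M.iterValue (M.excessCost K) α N x :=
  forall_congr' fun x => by
    rw [costN_eq_shiftEReal hK, valueN_eq_shiftEReal hK hW,
      (strictMono_shiftEReal _).injective.eq_iff]

theorem isDiscountOptimal_iff (hα : (α : ℝ) < 1) {π : M.Policy} : IsDiscountOptimal α π ↔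
    ∀ x, totalCostInf (M.excessCost K) α π x = M.limValue (M.excessCost K) α x :=
  forall_congr' fun x => by
    rw [costInf_eq_shiftEReal hK α hα, valueInf_eq_shiftEReal hK hW α hα,
      (strictMono_shiftEReal _).injective.eq_iff]

theorem exists_isHorizonOptimal_markovPolicy (N : ℕ) :
    ∃ φ : ℕ → M.Selector, IsHorizonOptimal α N (M.markovPolicy φ) :=
  ((hW.wStarCost_excessCost hK).exists_markovPolicy_totalCost_eq α N).imp
    fun _ => (isHorizonOptimal_iff hK hW α).2

theorem isHorizonOptimal_markovPolicy {N : ℕ} {φ : ℕ → M.Selector}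
    (hφ : ∀ n < N, ∀ x, (φ (N - 1 - n)).1 x ∈ M.argminN α n x) :
    IsHorizonOptimal α N (M.markovPolicy φ) := by
  have hc := hW.wStarCost_excessCost hK
  simp only [argminN_eq_minimizers hK hW] at hφ
  exact (isHorizonOptimal_iff hK hW α).2 (totalCost_markovPolicy measurable_excessCost
    (hc.measurable_iterValue α) hφ)

theorem exists_isDiscountOptimal_stationaryPolicy (hα : (α : ℝ) < 1) :
    ∃ φ : M.Selector, IsDiscountOptimal α (M.stationaryPolicy φ) :=
  ((hW.wStarCost_excessCost hK).exists_stationaryPolicy_totalCostInf_eq α).imp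
    fun _ => (isDiscountOptimal_iff hK hW α hα).2

theorem isDiscountOptimal_stationaryPolicy_iff (hα : (α : ℝ) < 1) {φ : M.Selector} :
    IsDiscountOptimal α (M.stationaryPolicy φ) ↔ ∀ x, φ.1 x ∈ M.argminInf α x := by
  have hc := hW.wStarCost_excessCost hK
  rw [isDiscountOptimal_iff hK hW α hα, argminInf_eq_minimizers hK hW α hα]
  exact hc.totalCostInf_stationaryPolicy_eq_iff α φ

/-! ### Inf-compact costs -/

omit hW

theorem AssumptionWu.infCompactOn_valueN_succ [T2Space X] (hWu : M.AssumptionWu) (n : ℕ) :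
    InfCompactOn (M.valueN α (n + 1)) Set.univ := by
  have hW := hWu.assumptionWStar
  have hc := hW.wStarCost_excessCost hK
  refine hWu.infCompact.univ_of_exists_add_le (lowerSemicontinuous_valueN hK hW α (n + 1))
    (α * (K * ∑ i ∈ Finset.range n, (α : ℝ) ^ i)) fun x => ?_
  obtain ⟨a, ha, h⟩ := argminN_nonempty hK hW α n x
  refine ⟨a, ha, ?_⟩
  rw [h, eta_eq_cost_add α (hc.measurable_iterValue α n) (valueN_eq_shiftEReal hK hW α n) ha]
  exact add_le_add_right (coe_le_shiftEReal _ _) _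

theorem AssumptionWu.infCompactOn_valueInf [T2Space X] (hWu : M.AssumptionWu)
    (hα : (α : ℝ) < 1) : InfCompactOn (M.valueInf α) Set.univ := by
  have hW := hWu.assumptionWStar
  have hc := hW.wStarCost_excessCost hK
  refine hWu.infCompact.univ_of_exists_add_le (lowerSemicontinuous_valueInf hK hW α hα)
    (α * (K * (1 - (α : ℝ))⁻¹)) fun x => ?_
  obtain ⟨a, ha, h⟩ := argminInf_nonempty hK hW α hα x
  refine ⟨a, ha, ?_⟩
  rw [h, eta_eq_cost_add α (hc.measurable_limValue α) (valueInf_eq_shiftEReal hK hW α hα) ha]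
  exact add_le_add_right (coe_le_shiftEReal _ _) _

end MDP

end

theorem mainTheorem2_general {X A : Type*}
    [TopologicalSpace X] [TopologicalSpace.MetrizableSpace X]
    [MeasurableSpace X] [OpensMeasurableSpace X]
    [TopologicalSpace A] [TopologicalSpace.MetrizableSpace A] [SecondCountableTopology A]
    [MeasurableSpace A] [BorelSpace A]
    (M : MDP X A) (α : ℝ) (hα : 0 ≤ α) :
    (M.AssumptionWStar →
      ((∀ n, LowerSemicontinuous (M.valueN α n)) ∧
        (α < 1 →
          LowerSemicontinuous (M.valueInf α) ∧
          (∀ x, Tendsto (fun n => M.valueN α n x) atTop (𝓝 (M.valueInf α x))) ∧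
          ((∀ p ∈ setGraph M.act, 0 ≤ M.cost p) →
            ∀ x, Monotone fun n => M.valueN α n x) ∧
          (∀ K : ℝ, (∀ p ∈ setGraph M.act, (K : EReal) ≤ M.cost p) →
            ∀ x, Monotone fun n =>
              M.valueN α n x - ((K * ∑ i ∈ Finset.range n, α ^ i : ℝ) : EReal)))) ∧
      ((∀ x, M.valueN α 0 x = 0) ∧
        ∀ n,
          (∀ x, IsLeast (M.eta α (M.valueN α n) x '' M.act x) (M.valueN α (n + 1) x)) ∧
          (∀ x, (M.argminN α n x).Nonempty) ∧
          MeasurableSet (setGraph (M.argminN α n)) ∧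
          (∀ x, M.valueN α (n + 1) x = ⊤ → M.argminN α n x = M.act x) ∧
          (∀ x, M.valueN α (n + 1) x < ⊤ → IsCompact (M.argminN α n x))) ∧
      (∀ N : ℕ, 1 ≤ N →
        (∃ φ : ℕ → M.Selector, MDP.IsHorizonOptimal α N (M.markovPolicy φ)) ∧
        ∀ φ : ℕ → M.Selector,
          (∀ n < N, ∀ x, (φ (N - 1 - n)).1 x ∈ M.argminN α n x) →
            MDP.IsHorizonOptimal α N (M.markovPolicy φ)) ∧
      (α < 1 →
        (∀ x, IsLeast (M.eta α (M.valueInf α) x '' M.act x) (M.valueInf α x)) ∧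
        (∀ x, (M.argminInf α x).Nonempty) ∧
        MeasurableSet (setGraph (M.argminInf α)) ∧
        (∀ x, M.valueInf α x = ⊤ → M.argminInf α x = M.act x) ∧
        (∀ x, M.valueInf α x < ⊤ → IsCompact (M.argminInf α x))) ∧
      (α < 1 →
        (∃ φ : M.Selector, MDP.IsDiscountOptimal α (M.stationaryPolicy φ)) ∧
        ∀ φ : M.Selector, MDP.IsDiscountOptimal α (M.stationaryPolicy φ) ↔
          ∀ x, φ.1 x ∈ M.argminInf α x)) ∧
    (M.AssumptionWu →
      (∀ n, 1 ≤ n → InfCompactOn (M.valueN α n) Set.univ) ∧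
      (α < 1 → InfCompactOn (M.valueInf α) Set.univ)) := by
  lift α to NNReal using hα
  obtain ⟨K, hK⟩ := M.cost_bddBelow
  refine ⟨fun hW => ⟨⟨MDP.lowerSemicontinuous_valueN hK hW α, fun hα => ⟨
      MDP.lowerSemicontinuous_valueInf hK hW α hα, MDP.tendsto_valueN hK hW α hα, ?_,
      fun _ hK' => MDP.monotone_valueN_sub hK' hW α⟩⟩,
    ⟨MDP.valueN_zero α, fun n => ⟨MDP.isLeast_valueN_succ hK hW α n,
      MDP.argminN_nonempty hK hW α n, MDP.measurableSet_setGraph_argminN hK hW α n,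
      fun _ => MDP.argminN_eq_act hK hW α, fun _ => MDP.isCompact_argminN hK hW α⟩⟩,
    fun N _ => ⟨MDP.exists_isHorizonOptimal_markovPolicy hK hW α N,
      fun _ => MDP.isHorizonOptimal_markovPolicy hK hW α⟩,
    fun hα => ⟨MDP.isLeast_valueInf hK hW α hα, MDP.argminInf_nonempty hK hW α hα,
      MDP.measurableSet_setGraph_argminInf hK hW α hα,
      fun _ => MDP.argminInf_eq_act hK hW α hα, fun _ => MDP.isCompact_argminInf hK hW α hα⟩,
    fun hα => ⟨MDP.exists_isDiscountOptimal_stationaryPolicy hK hW α hα,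
      fun _ => MDP.isDiscountOptimal_stationaryPolicy_iff hK hW α hα⟩⟩,
    fun hWu => ⟨?_, hWu.infCompactOn_valueInf hK α⟩⟩
  · intro h x
    simpa using MDP.monotone_valueN_sub (K := 0) (by simpa using h) hW α x
  · exact Nat.le_induction (hWu.infCompactOn_valueN_succ hK α 0)
      fun n _ _ => hWu.infCompactOn_valueN_succ hK α n

theorem mainTheorem2 {𝒳 𝒜 : Type*}
    [TopologicalSpace 𝒳] [PolishSpace 𝒳] [MeasurableSpace 𝒳] [BorelSpace 𝒳]
    [TopologicalSpace 𝒜] [PolishSpace 𝒜] [MeasurableSpace 𝒜] [BorelSpace 𝒜]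
    (X : Set 𝒳) (hX : MeasurableSet X) (A : Set 𝒜) (hA : MeasurableSet A)
    (M : MDP X A) (α : ℝ) (hα : 0 ≤ α) :
    (M.AssumptionWStar →
      -- (i)
      ((∀ n, LowerSemicontinuous (M.valueN α n)) ∧
        (α < 1 →
          LowerSemicontinuous (M.valueInf α) ∧
          (∀ x, Tendsto (fun n => M.valueN α n x) atTop (𝓝 (M.valueInf α x))) ∧
          ((∀ p ∈ setGraph M.act, 0 ≤ M.cost p) →
            ∀ x, Monotone fun n => M.valueN α n x) ∧
          (∀ K : ℝ, (∀ p ∈ setGraph M.act, (K : EReal) ≤ M.cost p) →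
            ∀ x, Monotone fun n =>
              M.valueN α n x - ((K * ∑ i ∈ Finset.range n, α ^ i : ℝ) : EReal)))) ∧
      -- (ii)
      ((∀ x, M.valueN α 0 x = 0) ∧
        ∀ n,
          (∀ x, IsLeast (M.eta α (M.valueN α n) x '' M.act x) (M.valueN α (n + 1) x)) ∧
          (∀ x, (M.argminN α n x).Nonempty) ∧
          MeasurableSet (setGraph (M.argminN α n)) ∧
          (∀ x, M.valueN α (n + 1) x = ⊤ → M.argminN α n x = M.act x) ∧
          (∀ x, M.valueN α (n + 1) x < ⊤ → IsCompact (M.argminN α n x))) ∧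
      -- (iii)
      (∀ N : ℕ, 1 ≤ N →
        (∃ φ : ℕ → M.Selector, MDP.IsHorizonOptimal α N (M.markovPolicy φ)) ∧
        ∀ φ : ℕ → M.Selector,
          (∀ n < N, ∀ x, (φ (N - 1 - n)).1 x ∈ M.argminN α n x) →
            MDP.IsHorizonOptimal α N (M.markovPolicy φ)) ∧
      -- (iv)
      (α < 1 →
        (∀ x, IsLeast (M.eta α (M.valueInf α) x '' M.act x) (M.valueInf α x)) ∧
        (∀ x, (M.argminInf α x).Nonempty) ∧
        MeasurableSet (setGraph (M.argminInf α)) ∧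
        (∀ x, M.valueInf α x = ⊤ → M.argminInf α x = M.act x) ∧
        (∀ x, M.valueInf α x < ⊤ → IsCompact (M.argminInf α x))) ∧
      -- (v)
      (α < 1 →
        (∃ φ : M.Selector, MDP.IsDiscountOptimal α (M.stationaryPolicy φ)) ∧
        ∀ φ : M.Selector, MDP.IsDiscountOptimal α (M.stationaryPolicy φ) ↔
          ∀ x, φ.1 x ∈ M.argminInf α x)) ∧
    -- (vi)
    (M.AssumptionWu →
      (∀ n, 1 ≤ n → InfCompactOn (M.valueN α n) Set.univ) ∧
      (α < 1 → InfCompactOn (M.valueInf α) Set.univ)) :=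
  mainTheorem2_general M α hα
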